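/- Let $q$ (multiplication by the coordinate) and $p=-i\,\partial_q$ be the position and momentum operators on $L^2(\mathbb R)$, so that $[q,p]=i$, and let $x=(q,p)^{\mathrm T}$ and $\mathbf J=\begin{pmatrix}0&1\\-1&0\end{pmatrix}$. For a density operator $\rho$ write $\mathbf E A=\mathrm{Tr}(\rho A)$. Let $\rho$ be a Gaussian state, that is, for some $\mu=(\kappa,\mu_2)^{\mathrm T}\in\mathbb R^2$ and some real symmetric $\Sigma=(\sigma_{jk})\in\mathbb R^{2\times2}$, $$\mathbf E\, e^{i u^{\mathrm T}(x-\mu)}=e^{-u^{\mathrm T}\Sigma u/2}\qquad\text{for all }u\in\mathbb R^2,$$ and put $\xi=x-\mu$, $\chi=q-\kappa$ and $S=\Sigma+\tfrac i2\mathbf J$. Then $\mathbf E x=\mu$ and $\mathbf E(\xi_j\xi_k)=S_{jk}$; in particular $\kappa=\mathbf E q$ and $\sigma_{11}=\mathbf E((q-\kappa)^2)$. For an operator $A$ with $\eta=A-\mathbf E A$, call $(\alpha,\beta,R)$ optimal for $A$ if it minimizes $$Q(\alpha,\beta,R)=\mathbf E\big((\eta-\alpha-\beta^{\mathrm T}\xi-\tfrac12\xi^{\mathrm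 T}R\,\xi)^2\big)$$ over all $\alpha\in\mathbb R$, $\beta\in\mathbb R^2$ and real symmetric $2\times2$ matrices $R$. Let $\omega_0,f\in\mathbb R$. (a) For the Hamiltonian $H=\tfrac12p^2+\tfrac12\omega_0^2q^2+fq^4$ of the quantum Duffing oscillator, all the expectations involved exist, and the triple $$\beta_\diamond=\begin{pmatrix}\omega_0^2+4f(\kappa^2+3\sigma_{11})&0\\0&1\end{pmatrix}\mu,\qquad R_\diamond=\begin{pmatrix}\omega_0^2+12f(\kappa^2+\sigma_{11})&0\\0&1\end{pmatrix},\qquad \alpha_\diamond=-\tfrac12\mathrm{Tr}(\Sigma R_\diamond)$$ is optimal for $H$. (b) The approximation of the quartic part does not depend on the momentum: for the non-quadratic part $4\kappa\chi^3+\chi^4$ of $q^4=\kappa^4+4\kappa^3\chi+6\kappa^2\chi^2+4\kappa\chi^3+\chi^4$ the triple $$\alpha=-6\sigma_{11}^2,\qquad \beta=(12\kappa\sigma_{11},0)^{\mathrm T},\qquad R=\mathrm{diag}(12\sigma_{11},0)$$ is optimal, and for $q^4$ itself the triple $$\alpha=-6\sigma_{11}(\kappa^2+\sigma_{11}),\qquad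 \beta=(4\kappa(\kappa^2+3\sigma_{11}),0)^{\mathrm T},\qquad R=\mathrm{diag}(12(\kappa^2+\sigma_{11}),0)$$ is optimal; again all the expectations involved exist. (c) If $S$ is nonsingular, then in each of these three cases the optimal triple is unique. -/

import Mathlib

open MeasureTheory
open scoped ContDiff Matrix

noncomputable section

namespace QuantumDuffing

/-! ### Partially defined operators on `L²(ℝ)` -/

/-- The Hilbert space `L²(ℝ; ℂ)` of a particle on the real line. -/
abbrev L2 : Type := Lp ℂ 2 (volume : Measure ℝ)

/-- Linear operators on `L²(ℝ)` with a domain that need not be the whole space. Mathlib's sum and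
difference of such operators have the intersection of the domains as their domain. -/
abbrev Op : Type := L2 →ₗ.[ℂ] L2

/-- The identity operator. -/
def idOp : Op := LinearMap.toPMap LinearMap.id ⊤

/-- The product `A B`, with its natural domain `{ψ ∈ dom B | B ψ ∈ dom A}`. -/
def opMul (A B : Op) : Op where
  domain :=
    { carrier := {ψ | ∃ h : ψ ∈ B.domain, B ⟨ψ, h⟩ ∈ A.domain}
      add_mem' := fun ⟨h, hA⟩ ⟨h', hA'⟩ =>
        ⟨B.domain.add_mem h h', (B.map_add ⟨_, h⟩ ⟨_, h'⟩).symm ▸ A.domain.add_mem hA hA'⟩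
      zero_mem' := ⟨B.domain.zero_mem, B.map_zero.symm ▸ A.domain.zero_mem⟩
      smul_mem' := fun c _ ⟨h, hA⟩ =>
        ⟨B.domain.smul_mem c h, (B.map_smul c ⟨_, h⟩).symm ▸ A.domain.smul_mem c hA⟩ }
  toFun :=
    { toFun := fun ψ => A ⟨B ⟨ψ.1, ψ.2.choose⟩, ψ.2.choose_spec⟩
      map_add' := fun ψ φ => by
        rw [← LinearPMap.map_add]
        congr 1
        apply Subtype.ext
        exact B.map_add ⟨ψ.1, ψ.2.choose⟩ ⟨φ.1, φ.2.choose⟩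
      map_smul' := fun c ψ => by
        rw [RingHom.id_apply, ← LinearPMap.map_smul]
        congr 1
        apply Subtype.ext
        exact B.map_smul c ⟨ψ.1, ψ.2.choose⟩ }

/-- The powers `A ^ n`, with their natural domains. -/
def opPow (A : Op) : ℕ → Op
  | 0 => idOp
  | n + 1 => opMul A (opPow A n)

/-! ### Position, momentum and Weyl operators -/

/-- The position operator `(q ψ)(x) = x ψ(x)` on its maximal domain. -/
def position : Op where
  domain :=
    { carrier := {ψ | MemLp (fun x : ℝ => (x : ℂ) * ψ x) 2 volume}
      add_mem' := fun {ψ φ} hψ hφ => by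
        refine (MemLp.add hψ hφ).ae_eq ?_
        filter_upwards [Lp.coeFn_add ψ φ] with x hx
        simp only [hx, Pi.add_apply, mul_add]
      zero_mem' := by
        refine (MemLp.zero' : MemLp (fun _ : ℝ => (0 : ℂ)) 2 volume).ae_eq ?_
        filter_upwards [Lp.coeFn_zero ℂ 2 (volume : Measure ℝ)] with x hx
        simp only [hx, Pi.zero_apply, mul_zero]
      smul_mem' := fun c ψ hψ => by
        refine (MemLp.const_smul hψ c).ae_eq ?_
        filter_upwards [Lp.coeFn_smul c ψ] with x hx
        simp only [hx, Pi.smul_apply, smul_eq_mul, mul_left_comm] }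
  toFun :=
    { toFun := fun ψ => MemLp.toLp (fun x : ℝ => (x : ℂ) * ψ.1 x) ψ.2
      map_add' := fun ψ φ => by
        rw [← MemLp.toLp_add]
        refine MemLp.toLp_congr _ _ ?_
        filter_upwards [Lp.coeFn_add ψ.1 φ.1] with x hx
        change (x : ℂ) * (ψ.1 + φ.1 : L2) x = x * ψ.1 x + x * φ.1 x
        rw [hx, Pi.add_apply, mul_add]
      map_smul' := fun c ψ => by
        rw [RingHom.id_apply, ← MemLp.toLp_const_smul]
        refine MemLp.toLp_congr _ _ ?_
        filter_upwards [Lp.coeFn_smul c ψ.1] with x hx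
        change (x : ℂ) * (c • ψ.1 : L2) x = c * (x * ψ.1 x)
        rw [hx, Pi.smul_apply, smul_eq_mul, mul_left_comm] }

/-- `φ` is the weak derivative of `ψ`. -/
def HasWeakDeriv (ψ φ : L2) : Prop :=
  ∀ g : ℝ → ℝ, ContDiff ℝ ∞ g → HasCompactSupport g →
    ∫ x, deriv g x • ψ x = - ∫ x, g x • φ x

theorem integrable_test_smul {g : ℝ → ℝ} (hg : Continuous g) (hs : HasCompactSupport g) (ψ : L2) :
    Integrable (fun x => g x • ψ x) :=
  ((Lp.memLp ψ).locallyIntegrable (by norm_num)).integrable_smul_left_of_hasCompactSupport hg hs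

theorem HasWeakDeriv.add {ψ φ ψ' φ' : L2} (h : HasWeakDeriv ψ φ) (h' : HasWeakDeriv ψ' φ') :
    HasWeakDeriv (ψ + ψ') (φ + φ') := by
  intro g hg hs
  have hd : Continuous (deriv g) := hg.continuous_deriv (by simp)
  have e1 : ∫ x, deriv g x • (ψ + ψ' : L2) x = ∫ x, (deriv g x • ψ x + deriv g x • ψ' x) := by
    refine integral_congr_ae ?_
    filter_upwards [Lp.coeFn_add ψ ψ'] with x hx
    simp only [hx, Pi.add_apply, smul_add]
  have e2 : ∫ x, g x • (φ + φ' : L2) x = ∫ x, (g x • φ x + g x • φ' x) := by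
    refine integral_congr_ae ?_
    filter_upwards [Lp.coeFn_add φ φ'] with x hx
    simp only [hx, Pi.add_apply, smul_add]
  rw [e1, e2, integral_add (integrable_test_smul hd hs.deriv ψ) (integrable_test_smul hd hs.deriv ψ'),
    integral_add (integrable_test_smul hg.continuous hs φ) (integrable_test_smul hg.continuous hs φ'),
    h g hg hs, h' g hg hs]
  ring

theorem HasWeakDeriv.smul {ψ φ : L2} (c : ℂ) (h : HasWeakDeriv ψ φ) :
    HasWeakDeriv (c • ψ) (c • φ) := by
  intro g hg hs
  have e1 : ∫ x, deriv g x • (c • ψ : L2) x = ∫ x, c • (deriv g x • ψ x) := by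
    refine integral_congr_ae ?_
    filter_upwards [Lp.coeFn_smul c ψ] with x hx
    simp only [hx, Pi.smul_apply, smul_eq_mul, Complex.real_smul, mul_left_comm]
  have e2 : ∫ x, g x • (c • φ : L2) x = ∫ x, c • (g x • φ x) := by
    refine integral_congr_ae ?_
    filter_upwards [Lp.coeFn_smul c φ] with x hx
    simp only [hx, Pi.smul_apply, smul_eq_mul, Complex.real_smul, mul_left_comm]
  rw [e1, e2, integral_smul, integral_smul, h g hg hs, smul_neg]

theorem HasWeakDeriv.unique {ψ φ φ' : L2} (h : HasWeakDeriv ψ φ) (h' : HasWeakDeriv ψ φ') :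
    φ = φ' := by
  apply Lp.ext
  refine ae_eq_of_integral_contDiff_smul_eq ((Lp.memLp φ).locallyIntegrable (by norm_num))
    ((Lp.memLp φ').locallyIntegrable (by norm_num)) fun g hg hs => ?_
  exact neg_injective ((h g hg hs).symm.trans (h' g hg hs))

theorem hasWeakDeriv_zero : HasWeakDeriv 0 0 := by
  intro g hg hs
  have e : ∀ k : ℝ → ℝ, ∫ x, k x • (0 : L2) x = 0 := fun k => by
    rw [← integral_zero ℝ ℂ]
    refine integral_congr_ae ?_
    filter_upwards [Lp.coeFn_zero ℂ 2 (volume : Measure ℝ)] with x hx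
    simp only [hx, Pi.zero_apply, smul_zero]
  rw [e, e, neg_zero]

/-- The momentum operator `p ψ = -i ψ'` on its maximal domain `H¹(ℝ)`. -/
def momentum : Op where
  domain :=
    { carrier := {ψ | ∃ φ, HasWeakDeriv ψ φ}
      add_mem' := fun ⟨_, h⟩ ⟨_, h'⟩ => ⟨_, h.add h'⟩
      zero_mem' := ⟨0, hasWeakDeriv_zero⟩
      smul_mem' := fun c _ ⟨_, h⟩ => ⟨_, h.smul c⟩ }
  toFun :=
    { toFun := fun ψ => (-Complex.I) • Classical.choose ψ.2
      map_add' := fun ψ φ => by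
        rw [← smul_add]
        congr 1
        exact (Classical.choose_spec (ψ + φ).2).unique
          ((Classical.choose_spec ψ.2).add (Classical.choose_spec φ.2))
      map_smul' := fun c ψ => by
        rw [RingHom.id_apply, smul_comm c]
        congr 1
        exact (Classical.choose_spec (c • ψ).2).unique ((Classical.choose_spec ψ.2).smul c) }

/-- The vector `x = (q, p)` of system observables. -/
def obs : Fin 2 → Op := ![position, momentum]

/-- The matrix `J`, for which `[x_j, x_k] = i J_{jk}`. -/
def J : Matrix (Fin 2) (Fin 2) ℝ := !![0, 1; -1, 0]

theorem memLp_weyl (u : Fin 2 → ℝ) (ψ : L2) :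
    MemLp (fun x : ℝ => Complex.exp (Complex.I * ((u 0 * x + u 0 * u 1 / 2 : ℝ) : ℂ)) *
      ψ (x + u 1)) 2 volume := by
  have h : MemLp (fun x : ℝ => ψ (x + u 1)) 2 volume :=
    (Lp.memLp ψ).comp_measurePreserving (measurePreserving_add_right volume (u 1))
  refine h.of_le (AEStronglyMeasurable.mul ?_ h.1) (Filter.Eventually.of_forall fun x => ?_)
  · exact (by fun_prop : Continuous fun x : ℝ =>
      Complex.exp (Complex.I * ((u 0 * x + u 0 * u 1 / 2 : ℝ) : ℂ))).aestronglyMeasurable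
  · rw [norm_mul, mul_comm Complex.I, Complex.norm_exp_ofReal_mul_I, one_mul]

/-- The Weyl operator `exp (i uᵀ x) = exp (i (u₀ q + u₁ p))`, which acts as
`ψ ↦ exp (i (u₀ x + u₀ u₁ / 2)) ψ(x + u₁)`: the factor `exp (i u₀ u₁ / 2)` comes from
`exp (A + B) = exp A exp B exp (-[A, B] / 2)` with `A = i u₀ q`, `B = i u₁ p`. -/
def weyl (u : Fin 2 → ℝ) : L2 →ₗ[ℂ] L2 where
  toFun ψ := MemLp.toLp _ (memLp_weyl u ψ)
  map_add' ψ φ := by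
    rw [← MemLp.toLp_add]
    refine MemLp.toLp_congr _ _ ?_
    filter_upwards [(measurePreserving_add_right volume (u 1)).quasiMeasurePreserving.ae
      (Lp.coeFn_add ψ φ)] with x hx
    simp only [Pi.add_apply] at hx ⊢
    rw [hx, mul_add]
  map_smul' c ψ := by
    rw [RingHom.id_apply, ← MemLp.toLp_const_smul]
    refine MemLp.toLp_congr _ _ ?_
    filter_upwards [(measurePreserving_add_right volume (u 1)).quasiMeasurePreserving.ae
      (Lp.coeFn_smul c ψ)] with x hx
    simp only [Pi.smul_apply, smul_eq_mul] at hx ⊢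
    rw [hx, mul_left_comm]

/-! ### States and expectations -/

/-- The everywhere defined operator `T` has trace `c`: its diagonal sum converges unconditionally
to `c` in every orthonormal basis. For a bounded `T` this says that `T` is of trace class with
`Tr T = c`. -/
def HasTrace (T : L2 → L2) (c : ℂ) : Prop :=
  ∀ (ι : Type) (e : HilbertBasis ι ℂ L2), HasSum (fun i => inner ℂ (e i) (T (e i))) c

/-- A density operator: a positive semi-definite self-adjoint operator with unit trace. -/
structure IsDensityOperator (ρ : L2 →L[ℂ] L2) : Prop where
  isPositive : ρ.IsPositive
  hasTrace : HasTrace ρ 1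

/-- The quantum expectation `E A = Tr (ρ A)` of the (possibly unbounded) operator `A` in the state
`ρ` exists and is equal to `c`: the range of `ρ` lies in the domain of `A`, and `Tr (A ρ) = c`. -/
def HasExpectation (ρ : L2 →L[ℂ] L2) (A : Op) (c : ℂ) : Prop :=
  ∃ h : ∀ ψ, ρ ψ ∈ A.domain, HasTrace (fun ψ => A ⟨ρ ψ, h ψ⟩) c

/-- The exponential `exp (i uᵀ (x - μ)) = exp (-i uᵀ μ) exp (i uᵀ x)`. -/
def centeredWeyl (μ u : Fin 2 → ℝ) : Op :=
  Complex.exp (-Complex.I * ((u ⬝ᵥ μ : ℝ) : ℂ)) • (weyl u).toPMap ⊤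

/-- The state `ρ` is Gaussian with mean vector `μ` and real covariance matrix `C`:
`E exp (i uᵀ (x - μ)) = exp (-uᵀ C u / 2)` for all `u ∈ ℝ²`. -/
structure IsGaussianState (ρ : L2 →L[ℂ] L2) (μ : Fin 2 → ℝ) (C : Matrix (Fin 2) (Fin 2) ℝ) :
    Prop where
  isDensityOperator : IsDensityOperator ρ
  isSymm : C.IsSymm
  charFun : ∀ u : Fin 2 → ℝ,
    HasExpectation ρ (centeredWeyl μ u) (Real.exp (-(u ⬝ᵥ C *ᵥ u) / 2) : ℝ)

/-- The quantum covariance matrix `S = C + i J / 2`. -/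
def quantumCov (C : Matrix (Fin 2) (Fin 2) ℝ) : Matrix (Fin 2) (Fin 2) ℂ :=
  Matrix.of fun j k => (C j k : ℂ) + Complex.I * (J j k : ℂ) / 2

/-! ### Mean square optimal quadratic approximation -/

/-- The centered observables `ξ = x - μ`. -/
def centeredObs (μ : Fin 2 → ℝ) (j : Fin 2) : Op := obs j - (μ j : ℂ) • idOp

/-- The quadratic operator `h_{α,β,R} = α + βᵀ ξ + ξᵀ R ξ / 2` with `ξ = x - μ`. -/
def quadOp (μ : Fin 2 → ℝ) (α : ℝ) (β : Fin 2 → ℝ) (R : Matrix (Fin 2) (Fin 2) ℝ) : Op :=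
  (α : ℂ) • idOp + ∑ j, (β j : ℂ) • centeredObs μ j +
    (1 / 2 : ℂ) • ∑ j, ∑ k, (R j k : ℂ) • opMul (centeredObs μ j) (centeredObs μ k)

/-- The mean square deviation `E ((η - h_{α,β,R})²)`, where `η = A - E A` and `E A = m`, exists and
is equal to `Q`. -/
def HasMeanSquareDev (ρ : L2 →L[ℂ] L2) (μ : Fin 2 → ℝ) (A : Op) (m : ℝ) (α : ℝ) (β : Fin 2 → ℝ)
    (R : Matrix (Fin 2) (Fin 2) ℝ) (Q : ℝ) : Prop :=
  HasExpectation ρ (opPow (A - (m : ℂ) • idOp - quadOp μ α β R) 2) Q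

/-- Among all `(α, β, R)` with a real scalar `α`, a real vector `β` and a real symmetric matrix `R`,
the given triple minimizes the mean square deviation of `η = A - E A` from `h_{α,β,R}` in the state
`ρ` with mean vector `μ`; the expectation of `A` and all the mean square deviations are required to
exist. -/
def IsOptimalQuadApprox (ρ : L2 →L[ℂ] L2) (μ : Fin 2 → ℝ) (A : Op) (α : ℝ) (β : Fin 2 → ℝ)
    (R : Matrix (Fin 2) (Fin 2) ℝ) : Prop :=
  R.IsSymm ∧ ∃ m : ℝ, HasExpectation ρ A m ∧ ∃ Q : ℝ, HasMeanSquareDev ρ μ A m α β R Q ∧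
    ∀ (α' : ℝ) (β' : Fin 2 → ℝ) (R' : Matrix (Fin 2) (Fin 2) ℝ), R'.IsSymm →
      ∃ Q' : ℝ, HasMeanSquareDev ρ μ A m α' β' R' Q' ∧ Q ≤ Q'

/-! ### The Duffing oscillator -/

/-- The Hamiltonian `H = p² / 2 + ω₀² q² / 2 + f q⁴`. -/
def duffing (ω₀ f : ℝ) : Op :=
  (1 / 2 : ℂ) • opPow momentum 2 + ((ω₀ ^ 2 / 2 : ℝ) : ℂ) • opPow position 2 +
    (f : ℂ) • opPow position 4

/-- The non-quadratic part `4 κ χ³ + χ⁴` of `q⁴ = κ⁴ + 4 κ³ χ + 6 κ² χ² + 4 κ χ³ + χ⁴`, where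
`χ = q - κ` and `κ = μ 0` is the mean position. -/
def nonquadPart (μ : Fin 2 → ℝ) : Op :=
  ((4 * μ 0 : ℝ) : ℂ) • opPow (centeredObs μ 0) 3 + opPow (centeredObs μ 0) 4

/-- The vector `N μ` with `N = diag (ω₀² + 4 f (κ² + 3 σ₁₁), 1)`. -/
def betaOpt (ω₀ f : ℝ) (μ : Fin 2 → ℝ) (C : Matrix (Fin 2) (Fin 2) ℝ) : Fin 2 → ℝ :=
  Matrix.diagonal ![ω₀ ^ 2 + 4 * f * (μ 0 ^ 2 + 3 * C 0 0), 1] *ᵥ μ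

/-- The matrix `diag (ω₀² + 12 f (κ² + σ₁₁), 1)`. -/
def ROpt (ω₀ f : ℝ) (μ : Fin 2 → ℝ) (C : Matrix (Fin 2) (Fin 2) ℝ) : Matrix (Fin 2) (Fin 2) ℝ :=
  Matrix.diagonal ![ω₀ ^ 2 + 12 * f * (μ 0 ^ 2 + C 0 0), 1]

end QuantumDuffing

end

open QuantumDuffing

/-! The problem reduces to orthogonal projection in a classical Gaussian L² space of polynomials.

A Gaussian state satisfies σ₁₁ > 0 and σ₁₂² + 1/4 ≤ σ₁₁σ₂₂ (`IsGaussianState.uncertainty`). Hence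
there is a mixture of pure Gaussian wave packets ψ_s with the same Weyl expectations: all ψ_s have
position variance a = σ₁₁ and position-momentum covariance b = σ₁₂, and the momentum shift s is
centred normal with variance d = σ₂₂ − (σ₁₂² + 1/4)/σ₁₁. A positive operator of finite trace is
determined by its Weyl traces (`eq_of_hasTrace_weyl`), so the state is this mixture
(`IsGaussianState.eq_superposition`).

For a polynomial P in the centred position y and the shift s put T P = ∫ |P ψ_s⟩⟨ψ_s|. The state is
T 1, the trace of T P is the expectation of P for independent y ~ N(0, a) and s ~ N(0, d), and q and
p turn T P into T (L P) for explicit first order operators L on polynomials. This settles the domain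
questions for all operators built from q and p, and turns expectations into Gaussian moments. The
maps L of q and p are symmetric in Gaussian L², so E((η − h)²) is the squared norm of the polynomial
obtained by applying the map of η − h to 1 (`PacketParam.hasMeanSquareDev`).

A quadratic h produces a polynomial of degree at most 2. For the stated triples the residual is a
multiple of H₄(y) + 4κ H₃(y), with Hermite polynomials of variance a, which is orthogonal to all
polynomials of degree at most 2. By Pythagoras any other triple adds the squared norm of the
difference of the quadratic parts (`PacketParam.isOptimalQuadApprox`). That norm is a sum of squares
with weights 1, a, d, 2a², ad, 2d². Since det S = ad, nonsingularity makes all weights positive and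
forces uniqueness (`PacketParam.eq_zero_of_gaussNorm_quadSymb`). -/

noncomputable section
namespace QuantumDuffing

/-! ### Operators intertwined with linear maps of a symbol space -/

section Intertwines

variable {W : Type*} [AddCommGroup W] [Module ℂ W] {T : W →ₗ[ℂ] L2 →L[ℂ] L2}

/-- On the ranges of the operators `T P`, the operator `A` acts as the map `L` of the symbols. -/
def Intertwines (T : W →ₗ[ℂ] L2 →L[ℂ] L2) (A : Op) (L : W →ₗ[ℂ] W) : Prop :=
  ∀ P φ, ∃ h : T P φ ∈ A.domain, A ⟨T P φ, h⟩ = T (L P) φ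

theorem apply_mk_congr {A : Op} {x y : L2} (e : x = y) (hx : x ∈ A.domain)
    (hy : y ∈ A.domain) : A ⟨x, hx⟩ = A ⟨y, hy⟩ := by
  subst e; rfl

theorem Intertwines.id : Intertwines T idOp LinearMap.id := fun _ _ => ⟨trivial, rfl⟩

theorem Intertwines.add {A B : Op} {L M : W →ₗ[ℂ] W} (hA : Intertwines T A L)
    (hB : Intertwines T B M) : Intertwines T (A + B) (L + M) := by
  intro P φ
  obtain ⟨h, e⟩ := hA P φ
  obtain ⟨h', e'⟩ := hB P φ
  refine ⟨⟨h, h'⟩, ?_⟩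
  rw [LinearPMap.add_apply, LinearMap.add_apply, map_add, _root_.add_apply, ← e, ← e']

theorem Intertwines.sub {A B : Op} {L M : W →ₗ[ℂ] W} (hA : Intertwines T A L)
    (hB : Intertwines T B M) : Intertwines T (A - B) (L - M) := by
  intro P φ
  obtain ⟨h, e⟩ := hA P φ
  obtain ⟨h', e'⟩ := hB P φ
  refine ⟨⟨h, h'⟩, ?_⟩
  rw [LinearPMap.sub_apply, LinearMap.sub_apply, map_sub, _root_.sub_apply, ← e, ← e']

theorem Intertwines.smul {A : Op} {L : W →ₗ[ℂ] W} (c : ℂ) (hA : Intertwines T A L) :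
    Intertwines T (c • A) (c • L) := by
  intro P φ
  obtain ⟨h, e⟩ := hA P φ
  refine ⟨h, ?_⟩
  rw [LinearPMap.smul_apply, LinearMap.smul_apply, map_smul, _root_.smul_apply, ← e]

theorem Intertwines.mul {A B : Op} {L M : W →ₗ[ℂ] W} (hA : Intertwines T A L)
    (hB : Intertwines T B M) : Intertwines T (opMul A B) (L ∘ₗ M) := by
  intro P φ
  obtain ⟨h', e'⟩ := hB P φ
  obtain ⟨h, e⟩ := hA (M P) φ
  have hm : B ⟨T P φ, h'⟩ ∈ A.domain := e' ▸ h
  refine ⟨⟨h', hm⟩, ?_⟩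
  rw [LinearMap.comp_apply, ← e]
  exact apply_mk_congr e' _ _

theorem Intertwines.pow {A : Op} {L : W →ₗ[ℂ] W} (hA : Intertwines T A L) (n : ℕ) :
    Intertwines T (opPow A n) (L ^ n) := by
  induction n with
  | zero => exact Intertwines.id
  | succ n ih => rw [pow_succ']; exact hA.mul ih

theorem intertwines_zero : Intertwines T 0 0 := by
  intro P φ
  refine ⟨trivial, ?_⟩
  simp

theorem Intertwines.sum {ι : Type*} (s : Finset ι) {A : ι → Op} {L : ι → W →ₗ[ℂ] W}
    (h : ∀ i, Intertwines T (A i) (L i)) : Intertwines T (∑ i ∈ s, A i) (∑ i ∈ s, L i) := by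
  classical
  induction s using Finset.induction_on with
  | empty => simpa using intertwines_zero
  | insert i s hi ih => rw [Finset.sum_insert hi, Finset.sum_insert hi]; exact (h i).add ih

/-- The intertwining relation already contains the domain condition, so an expectation reduces to
the trace of a single bounded operator. -/
theorem Intertwines.hasExpectation {A : Op} {L : W →ₗ[ℂ] W} (hA : Intertwines T A L) {P : W}
    {c : ℂ} (hc : HasTrace (T (L P)) c) : HasExpectation (T P) A c := by
  refine ⟨fun φ => (hA P φ).choose, ?_⟩
  have : (fun ψ => A ⟨T P ψ, (hA P ψ).choose⟩) = T (L P) :=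
    funext fun φ => (hA P φ).choose_spec
  rwa [this]

end Intertwines

/-- `HasTrace` quantifies over all orthonormal bases; it is not vacuous because a basis exists. -/
theorem HasTrace.unique {T : L2 → L2} {c c' : ℂ} (h : HasTrace T c) (h' : HasTrace T c') :
    c = c' := by
  obtain ⟨w, b, -⟩ := exists_hilbertBasis ℂ L2
  exact (h w b).unique (h' w b)

theorem HasExpectation.unique {ρ : L2 →L[ℂ] L2} {A : Op} {c c' : ℂ} (h : HasExpectation ρ A c)
    (h' : HasExpectation ρ A c') : c = c' := by
  obtain ⟨_, h⟩ := h
  obtain ⟨_, h'⟩ := h'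
  exact h.unique h'

/-! ### Traces of superpositions of operators of rank one -/


/-- Distinct basis vectors are at distance √2, so balls of radius 1/2 around them are disjoint open
sets in a separable space. Countability is needed to exchange basis sums with integrals. -/
theorem countable_hilbertBasis {ι : Type} (e : HilbertBasis ι ℂ L2) : Countable ι := by
  have hd : ∀ i j, i ≠ j → (1 : ℝ) ≤ dist (e i) (e j) := by
    intro i j hij
    have h := e.orthonormal
    have h1 : ‖e i - e j‖ ^ 2 = 2 := by
      have := @norm_sub_sq ℂ L2 _ _ _ (e i) (e j)
      rw [h.2 hij, h.1 i, h.1 j] at this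
      rw [this]; norm_num
    rw [dist_eq_norm]
    nlinarith [norm_nonneg (e i - e j)]
  have : Fact ((2 : ENNReal) ≠ ⊤) := ⟨by norm_num⟩
  have hc : (Set.univ : Set ι).Countable := by
    refine Set.PairwiseDisjoint.countable_of_isOpen (s := fun i => Metric.ball (e i) (1 / 2)) ?_
      (fun i _ => Metric.isOpen_ball) (fun i _ => ⟨e i, by simp⟩)
    intro i _ j _ hij
    exact Metric.ball_disjoint_ball (by have := hd i j hij; linarith)
  exact Set.countable_univ_iff.1 hc

/-- Cauchy–Schwarz for finite sums, followed by Bessel's inequality for each factor. -/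
theorem sum_norm_inner_mul_inner_le {H : Type*} [NormedAddCommGroup H] [InnerProductSpace ℂ H]
    {ι : Type*} {e : ι → H} (he : Orthonormal ℂ e) (s : Finset ι) (v w : H) :
    ∑ i ∈ s, ‖inner ℂ w (e i) * inner ℂ (e i) v‖ ≤ ‖w‖ * ‖v‖ := by
  have h := fun x : H => he.sum_inner_products_le (s := s) x
  calc ∑ i ∈ s, ‖inner ℂ w (e i) * inner ℂ (e i) v‖
      = ∑ i ∈ s, ‖inner ℂ (e i) w‖ * ‖inner ℂ (e i) v‖ := by
        refine Finset.sum_congr rfl fun i _ => ?_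
        rw [norm_mul, norm_inner_symm]
    _ ≤ √(∑ i ∈ s, ‖inner ℂ (e i) w‖ ^ 2) * √(∑ i ∈ s, ‖inner ℂ (e i) v‖ ^ 2) :=
        Real.sum_mul_le_sqrt_mul_sqrt _ _ _
    _ ≤ √(‖w‖ ^ 2) * √(‖v‖ ^ 2) := by gcongr <;> exact h _
    _ = ‖w‖ * ‖v‖ := by rw [Real.sqrt_sq (norm_nonneg _), Real.sqrt_sq (norm_nonneg _)]

/-- Parseval's identity holds for each parameter. The exchange of sum and integral is justified
because every finite sum of absolute values is at most ‖v‖‖w‖, the norm of the rank one operator,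
which is integrable. -/
theorem hasTrace_integral_rankOne {Ω : Type*} [MeasurableSpace Ω] {ν : Measure Ω} {v w : Ω → L2}
    (h : Integrable (fun s => InnerProductSpace.rankOne ℂ (v s) (w s)) ν) :
    HasTrace (∫ s, InnerProductSpace.rankOne ℂ (v s) (w s) ∂ν : L2 →L[ℂ] L2)
      (∫ s, inner ℂ (w s) (v s) ∂ν) := by
  intro ι e
  have := countable_hilbertBasis e
  have happ : ∀ φ, Integrable (fun s => InnerProductSpace.rankOne ℂ (v s) (w s) φ) ν :=
    fun φ => h.apply_continuousLinearMap φ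
  have e1 : ∀ i, inner ℂ (e i) ((∫ s, InnerProductSpace.rankOne ℂ (v s) (w s) ∂ν) (e i)) =
      ∫ s, inner ℂ (w s) (e i) * inner ℂ (e i) (v s) ∂ν := by
    intro i
    rw [ContinuousLinearMap.integral_apply h, ← integral_inner (happ (e i))]
    simp only [InnerProductSpace.rankOne_apply, inner_smul_right]
  have hint : ∀ i, Integrable (fun s => inner ℂ (w s) (e i) * inner ℂ (e i) (v s)) ν := by
    intro i
    have := (happ (e i)).const_inner (𝕜 := ℂ) (e i)
    simpa only [InnerProductSpace.rankOne_apply, inner_smul_right] using this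
  have e2 : ∀ s, inner ℂ (w s) (v s) = ∑' i, inner ℂ (w s) (e i) * inner ℂ (e i) (v s) :=
    fun s => (e.tsum_inner_mul_inner _ _).symm
  simp only [e1]
  rw [show (∫ s, inner ℂ (w s) (v s) ∂ν) =
    ∫ s, ∑' i, inner ℂ (w s) (e i) * inner ℂ (e i) (v s) ∂ν from
      integral_congr_ae (Filter.Eventually.of_forall e2)]
  refine hasSum_integral_of_summable_integral_norm hint ?_
  refine summable_of_sum_le (c := ∫ s, ‖InnerProductSpace.rankOne ℂ (v s) (w s)‖ ∂ν)
    (fun i => integral_nonneg fun s => norm_nonneg _) fun u => ?_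
  rw [← integral_finsetSum _ fun i _ => (hint i).norm]
  refine integral_mono (integrable_finsetSum _ fun i _ => (hint i).norm) h.norm fun s => ?_
  simp only [InnerProductSpace.norm_rankOne]
  rw [mul_comm]
  exact sum_norm_inner_mul_inner_le e.orthonormal u (v s) (w s)

end QuantumDuffing

end

noncomputable section

namespace QuantumDuffing

/-! ### Decomposition of positive operators of finite trace -/

theorem exists_isPositive_sqrt {H : Type*} [NormedAddCommGroup H] [InnerProductSpace ℂ H]
    [CompleteSpace H] {ρ : H →L[ℂ] H} (hρ : ρ.IsPositive) :
    ∃ B : H →L[ℂ] H, B.IsPositive ∧ ∀ x, B (B x) = ρ x := by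
  have h0 : 0 ≤ ρ := (ContinuousLinearMap.nonneg_iff_isPositive ρ).2 hρ
  refine ⟨CFC.sqrt ρ, (ContinuousLinearMap.nonneg_iff_isPositive _).1 (CFC.sqrt_nonneg ρ),
    fun x => ?_⟩
  conv_rhs => rw [← CFC.sqrt_mul_sqrt_self ρ h0]
  rfl

/-- The trace of `W B²` in an orthonormal basis `e` is the sum of `⟪B e, W B e⟫`. -/
theorem hasSum_inner_of_sqrt {H : Type*} [NormedAddCommGroup H] [InnerProductSpace ℂ H]
    [CompleteSpace H] {ι : Type*} (e : HilbertBasis ι ℂ H) {B : H →L[ℂ] H} (hB : B.IsPositive)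
    (hsq : Summable fun i => ‖B (e i)‖ ^ 2) (W : H →L[ℂ] H) {t : ℂ}
    (ht : HasSum (fun i => inner ℂ (e i) (W (B (B (e i))))) t) :
    HasSum (fun i => inner ℂ (B (e i)) (W (B (e i)))) t := by
  have hBs : ∀ x y, inner ℂ (B x) y = inner ℂ x (B y) := fun x y => hB.isSymmetric x y
  -- By Parseval, the rows of this double series sum to ⟪B e, W B e⟫ and the columns to ⟪e, W B² e⟫.
  -- It is absolutely summable because B is Hilbert–Schmidt, so both iterated sums agree.
  set a : ι × ι → ℂ := fun p =>
    inner ℂ (B (e p.1)) (e p.2) * inner ℂ (e p.2) (W (B (e p.1))) with ha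
  have hrow : ∀ j, HasSum (fun i => a (j, i)) (inner ℂ (B (e j)) (W (B (e j)))) := by
    intro j
    have h1 := e.hasSum_inner_mul_inner (B (e j)) (W (B (e j)))
    simpa only [ha] using h1
  have hcol : ∀ i, HasSum (fun j => a (j, i)) (inner ℂ (e i) (W (B (B (e i))))) := by
    intro i
    have h1 := e.hasSum_inner_mul_inner (B (W.adjoint (e i))) (B (e i))
    rw [hBs, ContinuousLinearMap.adjoint_inner_left] at h1
    refine h1.congr_fun fun j => ?_
    simp only [ha]
    rw [hBs (W.adjoint (e i)), ContinuousLinearMap.adjoint_inner_left, mul_comm, hBs (e j) (e i)]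
  have hsum : Summable a := by
    rw [← summable_norm_iff, summable_prod_of_nonneg fun p => norm_nonneg _]
    have hfin : ∀ (j : ι) (u : Finset ι), ∑ i ∈ u, ‖a (j, i)‖ ≤ ‖W‖ * ‖B (e j)‖ ^ 2 := by
      intro j u
      refine (sum_norm_inner_mul_inner_le e.orthonormal u (W (B (e j))) (B (e j))).trans ?_
      have := W.le_opNorm (B (e j))
      nlinarith [norm_nonneg (B (e j))]
    refine ⟨fun j => summable_of_sum_le (fun i => norm_nonneg _) (hfin j), ?_⟩
    refine Summable.of_nonneg_of_le (fun j => tsum_nonneg fun i => norm_nonneg _) (fun j => ?_)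
      (hsq.mul_left ‖W‖)
    exact Real.tsum_le_of_sum_le (fun i => norm_nonneg _) (hfin j)
  have h1 := hsum.hasSum.prod_fiberwise hrow
  have h2 := ((Equiv.prodComm ι ι).hasSum_iff.2 hsum.hasSum).prod_fiberwise hcol
  rwa [ht.unique h2]

/-- A positive operator of finite trace is a superposition of operators of rank one, which also
gives the traces of its products with bounded operators. -/
theorem exists_decomposition {ρ : L2 →L[ℂ] L2} (hρ : ρ.IsPositive) {c : ℂ} (hc : HasTrace ρ c) :
    ∃ (ι : Type) (_ : Countable ι) (f : ι → L2), Summable (fun i => ‖f i‖ ^ 2) ∧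
      (∀ x y, HasSum (fun i => inner ℂ x (f i) * inner ℂ (f i) y) (inner ℂ x (ρ y))) ∧
      ∀ (W : L2 →L[ℂ] L2) (t : ℂ), HasTrace (fun ψ => W (ρ ψ)) t →
        HasSum (fun i => inner ℂ (f i) (W (f i))) t := by
  obtain ⟨w, e, -⟩ := exists_hilbertBasis ℂ L2
  have hcount := countable_hilbertBasis e
  obtain ⟨B, hBpos, hBB⟩ := exists_isPositive_sqrt hρ
  have hBs : ∀ x y, inner ℂ (B x) y = inner ℂ x (B y) := fun x y => hBpos.isSymmetric x y
  have hsq : Summable fun i => ‖B (e i)‖ ^ 2 := by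
    have h1 := (hc w e).summable.norm
    refine h1.congr fun i => ?_
    rw [← hBB, ← hBs, inner_self_eq_norm_sq_to_K]
    simp
  -- With B the positive square root and e an orthonormal basis, the vectors B e give ρ = Σ |B e⟩⟨B
  -- e|.
  refine ⟨w, hcount, fun i => B (e i), hsq, fun x y => ?_, fun W t ht => ?_⟩
  · have := e.hasSum_inner_mul_inner (B x) (B y)
    rw [hBs, hBB] at this
    refine this.congr_fun fun i => ?_
    rw [hBs x, hBs (e i) y]
  · refine hasSum_inner_of_sqrt e hBpos hsq W ?_
    have := ht w e
    simpa only [hBB] using this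

/-! ### Weyl operators -/

theorem coeFn_weyl (u : Fin 2 → ℝ) (ψ : L2) : weyl u ψ =ᵐ[volume] fun x : ℝ =>
    Complex.exp (Complex.I * ((u 0 * x + u 0 * u 1 / 2 : ℝ) : ℂ)) * ψ (x + u 1) :=
  MemLp.coeFn_toLp (memLp_weyl u ψ)

theorem norm_weyl (u : Fin 2 → ℝ) (ψ : L2) : ‖weyl u ψ‖ = ‖ψ‖ := by
  have h1 : weyl u ψ = MemLp.toLp _ (memLp_weyl u ψ) := rfl
  rw [h1, Lp.norm_toLp, Lp.norm_def]
  congr 1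
  rw [← eLpNorm_comp_measurePreserving (Lp.aestronglyMeasurable ψ)
    (measurePreserving_add_right volume (u 1))]
  refine eLpNorm_congr_norm_ae (Filter.Eventually.of_forall fun x => ?_)
  rw [norm_mul, mul_comm Complex.I, Complex.norm_exp_ofReal_mul_I, one_mul]
  rfl

/-- The Weyl operator as a bounded operator. -/
def weylCLM (u : Fin 2 → ℝ) : L2 →L[ℂ] L2 :=
  (weyl u).mkContinuous 1 fun ψ => by rw [norm_weyl, one_mul]

theorem weylCLM_apply (u : Fin 2 → ℝ) (ψ : L2) : weylCLM u ψ = weyl u ψ := rfl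

/-- The expectation of a Weyl operator determines the sum of its diagonal matrix elements. -/
theorem hasTrace_weyl_of_charFun {ρ : L2 →L[ℂ] L2} {μ : Fin 2 → ℝ} {u : Fin 2 → ℝ} {c : ℂ}
    (h : HasExpectation ρ (centeredWeyl μ u) c) :
    HasTrace (fun ψ => Complex.exp (-Complex.I * ((u ⬝ᵥ μ : ℝ) : ℂ)) • weyl u (ρ ψ)) c := by
  obtain ⟨_, h⟩ := h
  exact h

end QuantumDuffing

end

noncomputable section

namespace QuantumDuffing

open scoped FourierTransform

/-! ### A state is determined by the expectations of the Weyl operators -/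

theorem memLp_test {g : ℝ → ℝ} (hg : Continuous g) (hs : HasCompactSupport g) :
    MemLp (fun x => (g x : ℂ)) 2 volume := by
  refine (Complex.continuous_ofReal.comp hg).memLp_of_hasCompactSupport ?_
  exact hs.comp_left (g := fun x : ℝ => (x : ℂ)) Complex.ofReal_zero

/-- A test function as an element of `L²(ℝ)`. -/
def testVec {g : ℝ → ℝ} (hg : Continuous g) (hs : HasCompactSupport g) : L2 :=
  (memLp_test hg hs).toLp _

theorem inner_testVec {g : ℝ → ℝ} (hg : Continuous g) (hs : HasCompactSupport g) (v : L2) :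
    inner ℂ (testVec hg hs) v = ∫ x, g x • v x := by
  rw [L2.inner_def]
  refine integral_congr_ae ?_
  filter_upwards [(memLp_test hg hs).coeFn_toLp] with x hx
  rw [testVec, hx]
  simp [mul_comm]

theorem ext_inner_testVec {v w : L2}
    (h : ∀ (g : ℝ → ℝ) (hg : ContDiff ℝ ∞ g) (hs : HasCompactSupport g),
      inner ℂ (testVec hg.continuous hs) v = inner ℂ (testVec hg.continuous hs) w) : v = w := by
  apply Lp.ext
  refine ae_eq_of_integral_contDiff_smul_eq ((Lp.memLp v).locallyIntegrable (by norm_num))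
    ((Lp.memLp w).locallyIntegrable (by norm_num)) fun g hg hs => ?_
  rw [← inner_testVec hg.continuous hs, ← inner_testVec hg.continuous hs, h g hg hs]

theorem integral_norm_mul_le {p q : ℝ → ℂ} (hp : MemLp p 2 volume) (hq : MemLp q 2 volume) :
    ∫ x, ‖p x‖ * ‖q x‖ ≤ ‖hp.toLp p‖ * ‖hq.toLp q‖ := by
  have h := real_inner_le_norm (hp.norm.toLp _) (hq.norm.toLp _)
  rw [L2.inner_def, Lp.norm_toLp, Lp.norm_toLp, eLpNorm_norm, eLpNorm_norm, ← Lp.norm_toLp p hp,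
    ← Lp.norm_toLp q hq] at h
  refine le_of_eq_of_le (integral_congr_ae ?_) h
  filter_upwards [hp.norm.coeFn_toLp, hq.norm.coeFn_toLp] with x h1 h2
  rw [h1, h2]
  simp [mul_comm]

/-- The correlation function of a vector, weighted by two test functions. -/
def correlation (g h : ℝ → ℝ) (v : L2) (t : ℝ) : ℂ :=
  ∫ x, ((g x * h (x + t) : ℝ) : ℂ) * (starRingEnd ℂ (v x) * v (x + t))

theorem integrable_mul_shift (v : L2) (t : ℝ) :
    Integrable (fun x => starRingEnd ℂ (v x) * v (x + t)) := by
  have h1 : MemLp (fun x : ℝ => v (x + t)) 2 volume :=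
    (Lp.memLp v).comp_measurePreserving (measurePreserving_add_right volume t)
  exact (Lp.memLp v).star.integrable_mul h1

theorem inner_weyl (v : L2) (u : Fin 2 → ℝ) : inner ℂ v (weyl u v) =
    ∫ x : ℝ, Complex.exp (Complex.I * ((u 0 * x + u 0 * u 1 / 2 : ℝ) : ℂ)) *
      (starRingEnd ℂ (v x) * v (x + u 1)) := by
  rw [L2.inner_def]
  refine integral_congr_ae ?_
  filter_upwards [coeFn_weyl u v] with x hx
  rw [hx]
  simp only [RCLike.inner_apply]
  ring

/-- For a fixed translation t, the Weyl matrix elements are, up to a phase, the Fourier transform of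
x ↦ conj (v x) v (x + t). The phase removes the factor exp(i u₀u₁/2) of the Weyl operator. -/
theorem fourier_mul_shift (v : L2) (t ξ : ℝ) :
    𝓕 (fun x => starRingEnd ℂ (v x) * v (x + t)) ξ =
      Complex.exp (Complex.I * ((Real.pi * ξ * t : ℝ) : ℂ)) *
        inner ℂ v (weyl ![-2 * Real.pi * ξ, t] v) := by
  rw [inner_weyl, Real.fourier_real_eq_integral_exp_smul, ← integral_const_mul]
  refine integral_congr_ae (Filter.Eventually.of_forall fun x => ?_)
  simp only [smul_eq_mul, Matrix.cons_val_zero, Matrix.cons_val_one]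
  rw [← mul_assoc (Complex.exp _) (Complex.exp _), ← Complex.exp_add, mul_assoc]
  congr 2
  push_cast
  ring

/-- The essential point is that k does not depend on v. It is, up to a phase, the inverse Fourier
transform of the smooth window g(x) h(x + t), and the formula is the self-duality of the Fourier
integral. The bound by ‖v‖² allows summation over a decomposition of the state. -/
theorem exists_correlation_eq {g h : ℝ → ℝ} (hg : ContDiff ℝ ∞ g) (hgs : HasCompactSupport g)
    (hh : ContDiff ℝ ∞ h) (t : ℝ) : ∃ k : ℝ → ℂ, Integrable k ∧ ∀ v,
      Integrable (fun ξ => inner ℂ v (weyl ![-2 * Real.pi * ξ, t] v) * k ξ) ∧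
      ∫ ξ, ‖inner ℂ v (weyl ![-2 * Real.pi * ξ, t] v) * k ξ‖ ≤ ‖v‖ ^ 2 * ∫ ξ, ‖k ξ‖ ∧
      correlation g h v t = ∫ ξ, inner ℂ v (weyl ![-2 * Real.pi * ξ, t] v) * k ξ := by
  have hcd : ContDiff ℝ ∞ fun x => ((g x * h (x + t) : ℝ) : ℂ) :=
    Complex.ofRealCLM.contDiff.comp (hg.mul (hh.comp (contDiff_id.add contDiff_const)))
  have hcs : HasCompactSupport fun x => ((g x * h (x + t) : ℝ) : ℂ) :=
    (hgs.mul_right (f' := fun x => h (x + t))).comp_left (g := fun x : ℝ => (x : ℂ))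
      Complex.ofReal_zero
  set K : SchwartzMap ℝ ℂ := hcs.toSchwartzMap hcd with hK
  set L : SchwartzMap ℝ ℂ := 𝓕⁻ K with hL
  have hLK : 𝓕 (L : ℝ → ℂ) = fun x => ((g x * h (x + t) : ℝ) : ℂ) := by
    rw [← SchwartzMap.fourier_coe, hL, FourierTransform.fourier_fourierInv_eq]
    rfl
  set k : ℝ → ℂ := fun ξ => Complex.exp (Complex.I * ((Real.pi * ξ * t : ℝ) : ℂ)) * L ξ with hk
  have hnk : ∀ ξ, ‖k ξ‖ = ‖L ξ‖ := fun ξ => by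
    rw [hk, norm_mul, mul_comm Complex.I, Complex.norm_exp_ofReal_mul_I, one_mul]
  have hkc : Continuous k := by
    have := L.continuous
    simp only [hk]
    fun_prop
  have hki : Integrable k :=
    L.integrable.mono hkc.aestronglyMeasurable (Filter.Eventually.of_forall fun ξ => (hnk ξ).le)
  refine ⟨k, hki, fun v => ?_⟩
  have hw := integrable_mul_shift v t
  have hF : ∀ ξ, 𝓕 (fun x => starRingEnd ℂ (v x) * v (x + t)) ξ * L ξ =
      inner ℂ v (weyl ![-2 * Real.pi * ξ, t] v) * k ξ := fun ξ => by
    rw [fourier_mul_shift, hk]; ring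
  have hb : ∀ ξ, ‖inner ℂ v (weyl ![-2 * Real.pi * ξ, t] v) * k ξ‖ ≤ ‖v‖ ^ 2 * ‖k ξ‖ := by
    intro ξ
    rw [norm_mul]
    gcongr
    refine (norm_inner_le_norm _ _).trans ?_
    rw [norm_weyl, sq]
  have hcont : Continuous (𝓕 (fun x => starRingEnd ℂ (v x) * v (x + t))) :=
    VectorFourier.fourierIntegral_continuous Real.continuous_fourierChar
      (innerSL ℝ).continuous₂ hw
  have hi : Integrable (fun ξ => inner ℂ v (weyl ![-2 * Real.pi * ξ, t] v) * k ξ) := by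
    refine (hki.norm.const_mul (‖v‖ ^ 2)).mono' ?_ (Filter.Eventually.of_forall hb)
    refine ((hcont.mul L.continuous).congr fun ξ => ?_).aestronglyMeasurable
    exact hF ξ
  refine ⟨hi, ?_, ?_⟩
  · rw [← integral_const_mul]
    exact integral_mono hi.norm (hki.norm.const_mul _) hb
  · have := VectorFourier.integral_fourierIntegral_smul_eq_flip (μ := volume) (ν := volume)
      (L := innerₗ ℝ) Real.continuous_fourierChar (innerSL ℝ).continuous₂ hw L.integrable
    rw [correlation]
    have e1 : ∀ ξ, VectorFourier.fourierIntegral 𝐞 volume (innerₗ ℝ)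
        (fun x => starRingEnd ℂ (v x) * v (x + t)) ξ • L ξ =
        inner ℂ v (weyl ![-2 * Real.pi * ξ, t] v) * k ξ := hF
    have e2 : VectorFourier.fourierIntegral 𝐞 volume (innerₗ ℝ).flip L =
        fun x => ((g x * h (x + t) : ℝ) : ℂ) := by
      rw [flip_innerₗ]; exact hLK
    rw [e2] at this
    simp only [e1] at this
    rw [this]
    refine integral_congr_ae (Filter.Eventually.of_forall fun x => ?_)
    simp only [smul_eq_mul]
    ring

/-- Integrating over t decouples x from x + t: the shear (x, t) ↦ (x, x + t) preserves Lebesgue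
measure, so Fubini gives a product of two one-dimensional integrals, each controlled by
Cauchy–Schwarz. -/
theorem integral_correlation {g h : ℝ → ℝ} (hg : Continuous g) (hgs : HasCompactSupport g)
    (hh : Continuous h) (hhs : HasCompactSupport h) (v : L2) :
    Integrable (correlation g h v) ∧
      ∫ t, ‖correlation g h v t‖ ≤ ‖testVec hg hgs‖ * ‖testVec hh hhs‖ * ‖v‖ ^ 2 ∧
      ∫ t, correlation g h v t =
        inner ℂ (testVec hh hhs) v * inner ℂ v (testVec hg hgs) := by
  set a : ℝ → ℂ := fun x => (g x : ℂ) * starRingEnd ℂ (v x) with ha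
  set b : ℝ → ℂ := fun x => (h x : ℂ) * v x with hb
  have hai : Integrable a := (memLp_test hg hgs).integrable_mul (Lp.memLp v).star
  have hbi : Integrable b := (memLp_test hh hhs).integrable_mul (Lp.memLp v)
  have hab : Integrable (fun p : ℝ × ℝ => a p.1 * b p.2) (volume.prod volume) := hai.mul_prod hbi
  have hmp := measurePreserving_prod_add (volume : Measure ℝ) (volume : Measure ℝ)
  have hsh : Integrable (fun p : ℝ × ℝ => a p.1 * b (p.1 + p.2)) (volume.prod volume) :=
    hmp.integrable_comp_of_integrable hab
  have hcor : ∀ t, correlation g h v t = ∫ x, a x * b (x + t) := fun t => by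
    refine integral_congr_ae (Filter.Eventually.of_forall fun x => ?_)
    simp only [ha, hb]
    push_cast
    ring
  have hci : Integrable (correlation g h v) := by
    rw [show correlation g h v = fun t => ∫ x, a x * b (x + t) from funext hcor]
    exact hsh.integral_prod_right
  have hna : ∫ x, ‖a x‖ ≤ ‖testVec hg hgs‖ * ‖v‖ := by
    have := integral_norm_mul_le (memLp_test hg hgs) (Lp.memLp v)
    rw [Lp.toLp_coeFn] at this
    simpa [ha, testVec, -Lp.norm_toLp] using this
  have hnb : ∫ x, ‖b x‖ ≤ ‖testVec hh hhs‖ * ‖v‖ := by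
    have := integral_norm_mul_le (memLp_test hh hhs) (Lp.memLp v)
    rw [Lp.toLp_coeFn] at this
    simpa [hb, testVec, -Lp.norm_toLp] using this
  refine ⟨hci, ?_, ?_⟩
  · calc ∫ t, ‖correlation g h v t‖ ≤ ∫ t, ∫ x, ‖a x * b (x + t)‖ := by
          refine integral_mono hci.norm hsh.norm.integral_prod_right fun t => ?_
          simp only [hcor]
          exact norm_integral_le_integral_norm _
      _ = ∫ p : ℝ × ℝ, ‖a p.1 * b (p.1 + p.2)‖ ∂(volume.prod volume) :=
          (integral_prod_symm _ hsh.norm).symm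
      _ = ∫ x, ∫ t, ‖a x‖ * ‖b (x + t)‖ := by
          rw [integral_prod _ hsh.norm]; simp only [norm_mul]
      _ = (∫ x, ‖a x‖) * ∫ x, ‖b x‖ := by
          simp only [integral_const_mul]
          simp only [integral_add_left_eq_self (fun x => ‖b x‖)]
          rw [integral_mul_const]
      _ ≤ _ := by
          have := mul_le_mul hna hnb (integral_nonneg fun _ => norm_nonneg _) (by positivity)
          linarith
  · have hA : ∫ x, a x = inner ℂ v (testVec hg hgs) := by
      rw [← inner_conj_symm, inner_testVec, ← integral_conj]
      simp [ha]
    have hB : ∫ x, b x = inner ℂ (testVec hh hhs) v := by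
      rw [inner_testVec]; simp [hb]
    calc ∫ t, correlation g h v t = ∫ t, ∫ x, a x * b (x + t) := by simp only [hcor]
      _ = ∫ x, ∫ t, a x * b (x + t) := by
          rw [← integral_prod_symm (fun p : ℝ × ℝ => a p.1 * b (p.1 + p.2)) hsh,
            integral_prod _ hsh]
      _ = _ := by
          simp only [integral_const_mul]
          simp only [integral_add_left_eq_self b]
          rw [integral_mul_const, hA, hB, mul_comm]

/-- A positive operator of finite trace is determined by the traces of its products with Weyl
operators. -/
theorem eq_of_hasTrace_weyl {ρ₁ ρ₂ : L2 →L[ℂ] L2} (h₁ : ρ₁.IsPositive) (h₂ : ρ₂.IsPositive)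
    {c₁ c₂ : ℂ} (hc₁ : HasTrace ρ₁ c₁) (hc₂ : HasTrace ρ₂ c₂) (τ : (Fin 2 → ℝ) → ℂ)
    (ht₁ : ∀ u, HasTrace (fun ψ => weyl u (ρ₁ ψ)) (τ u))
    (ht₂ : ∀ u, HasTrace (fun ψ => weyl u (ρ₂ ψ)) (τ u)) : ρ₁ = ρ₂ := by
  -- Matrix elements between test functions are expressed through τ alone, by summing the
  -- correlation formulas over a rank one decomposition of ρ.
  have key : ∀ (ρ : L2 →L[ℂ] L2) (c : ℂ), ρ.IsPositive → HasTrace ρ c →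
      (∀ u, HasTrace (fun ψ => weyl u (ρ ψ)) (τ u)) → ∀ (g h : ℝ → ℝ) (hg : ContDiff ℝ ∞ g)
      (hgs : HasCompactSupport g) (hh : ContDiff ℝ ∞ h) (hhs : HasCompactSupport h),
      inner ℂ (testVec hh.continuous hhs) (ρ (testVec hg.continuous hgs)) = ∫ t, ∫ ξ,
        τ ![-2 * Real.pi * ξ, t] * (exists_correlation_eq hg hgs hh t).choose ξ := by
    intro ρ c hρ hc ht g h hg hgs hh hhs
    obtain ⟨ι, _, f, hf, hfρ, hfW⟩ := exists_decomposition hρ hc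
    have hτ : ∀ u, HasSum (fun i => inner ℂ (f i) (weyl u (f i))) (τ u) := fun u =>
      hfW (weylCLM u) _ (ht u)
    have hsum : ∀ t, HasSum (fun i => correlation g h (f i) t) (∫ ξ,
        τ ![-2 * Real.pi * ξ, t] * (exists_correlation_eq hg hgs hh t).choose ξ) := by
      intro t
      obtain ⟨hk, hv⟩ := (exists_correlation_eq hg hgs hh t).choose_spec
      set k := (exists_correlation_eq hg hgs hh t).choose
      have h1 := hasSum_integral_of_summable_integral_norm (fun i => (hv (f i)).1)
        (Summable.of_nonneg_of_le (fun i => integral_nonneg fun ξ => norm_nonneg _)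
          (fun i => (hv (f i)).2.1) (hf.mul_right _))
      have h2 := h1.congr_fun fun i => (hv (f i)).2.2
      have e : ∀ ξ, τ ![-2 * Real.pi * ξ, t] * k ξ =
          ∑' i, inner ℂ (f i) (weyl ![-2 * Real.pi * ξ, t] (f i)) * k ξ := fun ξ =>
        (((hτ ![-2 * Real.pi * ξ, t]).mul_right (k ξ)).tsum_eq).symm
      simpa only [e] using h2
    have hcor := fun i =>
      integral_correlation hg.continuous hgs hh.continuous hhs (f i)
    have h3 := hasSum_integral_of_summable_integral_norm (fun i => (hcor i).1)
      (Summable.of_nonneg_of_le (fun i => integral_nonneg fun ξ => norm_nonneg _)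
        (fun i => (hcor i).2.1) (hf.mul_left _))
    have h4 := h3.congr_fun fun i => ((hcor i).2.2).symm
    rw [(hfρ _ _).unique h4]
    exact integral_congr_ae (Filter.Eventually.of_forall fun t => (hsum t).tsum_eq)
  have htest : ∀ (g : ℝ → ℝ) (hg : ContDiff ℝ ∞ g) (hgs : HasCompactSupport g),
      ρ₁ (testVec hg.continuous hgs) = ρ₂ (testVec hg.continuous hgs) := fun g hg hgs =>
    ext_inner_testVec fun h hh hhs => by
      rw [key ρ₁ c₁ h₁ hc₁ ht₁ g h hg hgs hh hhs, key ρ₂ c₂ h₂ hc₂ ht₂ g h hg hgs hh hhs]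
  -- Self-adjointness moves the operators onto the test function, which extends the equality to
  -- arbitrary ψ.
  ext1 ψ
  refine ext_inner_testVec fun g hg hgs => ?_
  have s₁ : inner ℂ (ρ₁ (testVec hg.continuous hgs)) ψ =
    inner ℂ (testVec hg.continuous hgs) (ρ₁ ψ) := h₁.isSymmetric _ _
  have s₂ : inner ℂ (ρ₂ (testVec hg.continuous hgs)) ψ =
    inner ℂ (testVec hg.continuous hgs) (ρ₂ ψ) := h₂.isSymmetric _ _
  rw [← s₁, ← s₂, htest g hg hgs]

end QuantumDuffing

end

noncomputable section

namespace QuantumDuffing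

/-! ### The uncertainty relation -/

/-- This is the Weyl commutation relation. The symplectic phase is the source of the term i/2 in the
quantum covariance. -/
theorem inner_weyl_weyl (v w : Fin 2 → ℝ) (ψ : L2) : inner ℂ (weyl v ψ) (weyl w ψ) =
    Complex.exp (Complex.I * (((v 0 * w 1 - w 0 * v 1) / 2 : ℝ) : ℂ)) *
      inner ℂ ψ (weyl (w - v) ψ) := by
  rw [inner_weyl, L2.inner_def, ← integral_const_mul]
  symm
  rw [← integral_add_right_eq_self _ (v 1)]
  refine integral_congr_ae ?_
  filter_upwards [coeFn_weyl v ψ, coeFn_weyl w ψ] with x h1 h2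
  rw [h1, h2]
  simp only [RCLike.inner_apply, map_mul, ← Complex.exp_conj, Complex.conj_I, Complex.conj_ofReal,
    Pi.sub_apply, add_add_sub_cancel]
  rw [show ∀ A B F G : ℂ, B * G * (A * F) = (A * B) * (F * G) from fun _ _ _ _ => by ring,
    ← Complex.exp_add, ← mul_assoc (Complex.exp _) (Complex.exp _), ← Complex.exp_add]
  congr 2
  push_cast
  ring

/-- Only a one-sided hypothesis is available in the application, where the variable is a square. -/
theorem deriv_nonneg_of_nonneg {G : ℝ → ℝ} {L : ℝ} (hG : HasDerivAt G L 0) (h0 : G 0 = 0)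
    (hpos : ∀ h, 0 < h → 0 ≤ G h) : 0 ≤ L := by
  have h1 := hG.tendsto_slope_zero_right
  refine ge_of_tendsto h1 ?_
  filter_upwards [self_mem_nhdsWithin] with t ht
  rw [zero_add, h0, sub_zero, smul_eq_mul]
  exact mul_nonneg (inv_nonneg.2 (le_of_lt ht)) (hpos t ht)

theorem dotProduct_mulVec_fin_two {C : Matrix (Fin 2) (Fin 2) ℝ} (hC : C.IsSymm)
    (u : Fin 2 → ℝ) :
    u ⬝ᵥ C *ᵥ u = C 0 0 * u 0 ^ 2 + 2 * C 0 1 * u 0 * u 1 + C 1 1 * u 1 ^ 2 := by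
  have := hC.apply 0 1
  simp [Matrix.mulVec, dotProduct, Fin.sum_univ_two]
  rw [this]
  ring

/-- The quantum covariance matrix of a Gaussian state is positive semi-definite. -/
theorem IsGaussianState.quantumCov_nonneg {ρ : L2 →L[ℂ] L2} {μ : Fin 2 → ℝ}
    {C : Matrix (Fin 2) (Fin 2) ℝ} (hρ : IsGaussianState ρ μ C) (c₁ c₂ : ℂ) :
    0 ≤ ‖c₁‖ ^ 2 * C 0 0 + ‖c₂‖ ^ 2 * C 1 1 +
      2 * (starRingEnd ℂ c₁ * c₂ * (C 0 1 + Complex.I / 2)).re := by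
  obtain ⟨ι, _, f, hf, -, hfW⟩ :=
    exists_decomposition hρ.isDensityOperator.isPositive hρ.isDensityOperator.hasTrace
  set P : (Fin 2 → ℝ) → ℂ := fun u => Complex.exp (-Complex.I * ((u ⬝ᵥ μ : ℝ) : ℂ)) with hP
  have hχ : ∀ u, HasSum (fun i => P u * inner ℂ (f i) (weyl u (f i)))
      ((Real.exp (-(u ⬝ᵥ C *ᵥ u) / 2) : ℝ) : ℂ) := by
    intro u
    have h1 := hfW (P u • weylCLM u) _ (hasTrace_weyl_of_charFun (hρ.charFun u))
    refine h1.congr_fun fun i => ?_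
    rw [_root_.smul_apply, inner_smul_right, weylCLM_apply]
  have hone : HasSum (fun i => inner ℂ (f i) (f i)) (1 : ℂ) :=
    hfW (ContinuousLinearMap.id ℂ L2) _ hρ.isDensityOperator.hasTrace
  set a := C 0 0
  set b := C 0 1
  set c := C 1 1
  -- `Z h` is the expectation of (V − 1)*(W − 1) for the centred Weyl operators V, W in the
  -- directions (√h, 0) and (0, √h). `G h` is the expectation of X*X for X = c₁(V − 1) + c₂(W − 1),
  -- hence nonnegative; its derivative at 0 is the quadratic form of S.
  set Z : ℝ → ℂ := fun h => Complex.exp (Complex.I * ((h / 2 : ℝ) : ℂ)) *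
    (Real.exp (-(a - 2 * b + c) * h / 2) : ℝ) - (Real.exp (-a * h / 2) : ℝ) -
      (Real.exp (-c * h / 2) : ℝ) + 1 with hZ
  set G : ℝ → ℝ := fun h => ‖c₁‖ ^ 2 * (2 - 2 * Real.exp (-a * h / 2)) +
    ‖c₂‖ ^ 2 * (2 - 2 * Real.exp (-c * h / 2)) + 2 * (starRingEnd ℂ c₁ * c₂ * Z h).re with hG
  have hpos : ∀ h, 0 < h → 0 ≤ G h := by
    intro h hh
    -- The displacement is √h, so the Gaussian exponents and the symplectic phase are linear in h.
    set ε := √h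
    have hε : ε ^ 2 = h := Real.sq_sqrt hh.le
    set v : Fin 2 → ℝ := ![ε, 0] with hv
    set w : Fin 2 → ℝ := ![0, ε] with hw
    have hnn : ∀ i, inner ℂ (weyl v (f i)) (weyl v (f i)) = inner ℂ (f i) (f i) := fun i => by
      rw [inner_self_eq_norm_sq_to_K, inner_self_eq_norm_sq_to_K, norm_weyl]
    have hnw : ∀ i, inner ℂ (weyl w (f i)) (weyl w (f i)) = inner ℂ (f i) (f i) := fun i => by
      rw [inner_self_eq_norm_sq_to_K, inner_self_eq_norm_sq_to_K, norm_weyl]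
    have hPP : ∀ u, starRingEnd ℂ (P u) * P u = 1 := fun u => by
      simp only [hP]
      rw [← Complex.exp_conj, ← Complex.exp_add]
      simp
    have hα : HasSum (fun i => P v * inner ℂ (f i) (weyl v (f i)))
        ((Real.exp (-a * h / 2) : ℝ) : ℂ) := by
      convert hχ v using 3
      rw [dotProduct_mulVec_fin_two hρ.isSymm, ← hε]
      simp [hv, a]
    have hβ : HasSum (fun i => P w * inner ℂ (f i) (weyl w (f i)))
        ((Real.exp (-c * h / 2) : ℝ) : ℂ) := by
      convert hχ w using 3
      rw [dotProduct_mulVec_fin_two hρ.isSymm, ← hε]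
      simp [hw, c]
    have hγ : HasSum (fun i => starRingEnd ℂ (P v) * P w * inner ℂ (weyl v (f i)) (weyl w (f i)))
        (Complex.exp (Complex.I * ((h / 2 : ℝ) : ℂ)) *
          (Real.exp (-(a - 2 * b + c) * h / 2) : ℝ)) := by
      have h1 := (hχ (w - v)).mul_left (Complex.exp (Complex.I * ((h / 2 : ℝ) : ℂ)))
      rw [dotProduct_mulVec_fin_two hρ.isSymm] at h1
      have e1 : -(C 0 0 * (w - v) 0 ^ 2 + 2 * C 0 1 * (w - v) 0 * (w - v) 1 +
          C 1 1 * (w - v) 1 ^ 2) / 2 = -(a - 2 * b + c) * h / 2 := by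
        rw [← hε]; simp [hv, hw, a, b, c]; ring
      rw [e1] at h1
      refine h1.congr_fun fun i => ?_
      rw [inner_weyl_weyl]
      have e2 : P (w - v) = starRingEnd ℂ (P v) * P w := by
        simp only [hP]
        rw [← Complex.exp_conj, ← Complex.exp_add, sub_dotProduct]
        congr 1
        simp
        ring
      have e3 : (v 0 * w 1 - w 0 * v 1) / 2 = h / 2 := by
        rw [← hε]; simp [hv, hw]; ring
      rw [e2, e3]
      ring
    have hconj : ∀ {F : ι → ℂ} {s : ℂ}, HasSum F s →
        HasSum (fun i => starRingEnd ℂ (F i)) (starRingEnd ℂ s) := fun hF =>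
      hF.map (starRingEnd ℂ) Complex.continuous_conj
    have hα' := hconj hα
    have hβ' := hconj hβ
    have hγ' := hconj hγ
    set A : ι → L2 := fun i => c₁ • (P v • weyl v (f i) - f i) + c₂ • (P w • weyl w (f i) - f i)
    have hexp : ∀ i, inner ℂ (A i) (A i) = 
        starRingEnd ℂ c₁ * c₁ * (2 * inner ℂ (f i) (f i) - P v * inner ℂ (f i) (weyl v (f i)) -
          starRingEnd ℂ (P v * inner ℂ (f i) (weyl v (f i)))) +
        starRingEnd ℂ c₂ * c₂ * (2 * inner ℂ (f i) (f i) - P w * inner ℂ (f i) (weyl w (f i)) -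
          starRingEnd ℂ (P w * inner ℂ (f i) (weyl w (f i)))) +
        starRingEnd ℂ c₁ * c₂ * (starRingEnd ℂ (P v) * P w *
          inner ℂ (weyl v (f i)) (weyl w (f i)) -
          starRingEnd ℂ (P v * inner ℂ (f i) (weyl v (f i))) -
          P w * inner ℂ (f i) (weyl w (f i)) + inner ℂ (f i) (f i)) +
        c₁ * starRingEnd ℂ c₂ * (starRingEnd ℂ (starRingEnd ℂ (P v) * P w *
          inner ℂ (weyl v (f i)) (weyl w (f i))) -
          P v * inner ℂ (f i) (weyl v (f i)) -
          starRingEnd ℂ (P w * inner ℂ (f i) (weyl w (f i))) + inner ℂ (f i) (f i)) := by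
      intro i
      simp only [A, inner_add_left, inner_add_right, inner_smul_left, inner_smul_right,
        inner_sub_left, inner_sub_right, map_mul, inner_conj_symm, hnn, hnw, Complex.conj_conj]
      linear_combination (starRingEnd ℂ c₁ * c₁ * inner ℂ (f i) (f i)) * hPP v +
        (starRingEnd ℂ c₂ * c₂ * inner ℂ (f i) (f i)) * hPP w
    have hS := (((((hone.mul_left 2).sub hα).sub hα').mul_left (starRingEnd ℂ c₁ * c₁)).add
      ((((hone.mul_left 2).sub hβ).sub hβ').mul_left (starRingEnd ℂ c₂ * c₂))).add
      ((((hγ.sub hα').sub hβ).add hone).mul_left (starRingEnd ℂ c₁ * c₂)) |>.add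
      ((((hγ'.sub hα).sub hβ').add hone).mul_left (c₁ * starRingEnd ℂ c₂))
    have hS' := hS.congr_fun hexp
    have hre := Complex.hasSum_re hS'
    have hnonneg := hre.nonneg fun i => inner_self_nonneg (𝕜 := ℂ) (x := A i)
    refine hnonneg.trans_eq ?_
    have n1 : starRingEnd ℂ c₁ * c₁ = ((‖c₁‖ ^ 2 : ℝ) : ℂ) := by
      rw [Complex.conj_mul']; push_cast; rfl
    have n2 : starRingEnd ℂ c₂ * c₂ = ((‖c₂‖ ^ 2 : ℝ) : ℂ) := by
      rw [Complex.conj_mul']; push_cast; rfl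
    have n3 : c₁ * starRingEnd ℂ c₂ * (starRingEnd ℂ (Complex.exp (Complex.I * ((h / 2 : ℝ) : ℂ)) *
          (Real.exp (-(a - 2 * b + c) * h / 2) : ℝ)) - (Real.exp (-a * h / 2) : ℝ) -
            starRingEnd ℂ ((Real.exp (-c * h / 2) : ℝ) : ℂ) + 1) =
        starRingEnd ℂ (starRingEnd ℂ c₁ * c₂ * Z h) := by
      simp only [hZ, map_mul, map_sub, map_add, Complex.conj_conj, Complex.conj_ofReal, map_one]
    rw [n3, n1, n2]
    simp only [Complex.conj_ofReal, hG, hZ, Complex.add_re, Complex.re_ofReal_mul, Complex.conj_re,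
      Complex.sub_re, Complex.ofReal_re]
    simp
    ring
  have hZd : HasDerivAt Z (b + Complex.I / 2) 0 := by
    have hc : HasDerivAt (fun h : ℝ => ((h / 2 : ℝ) : ℂ)) (1 / 2) 0 := by
      have := ((hasDerivAt_id (0 : ℝ)).div_const 2).ofReal_comp
      simpa using this
    have he : ∀ k : ℝ, HasDerivAt (fun h : ℝ => ((Real.exp (-k * h / 2) : ℝ) : ℂ))
        (((-k / 2 : ℝ)) : ℂ) 0 := by
      intro k
      have := ((((hasDerivAt_id (0 : ℝ)).const_mul (-k)).div_const 2).exp).ofReal_comp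
      simpa using this
    have := ((((hc.const_mul Complex.I).cexp.mul (he (a - 2 * b + c))).sub (he a)).sub
      (he c)).add_const 1
    refine HasDerivAt.congr_deriv (f := Z) this ?_
    simp
    ring
  have hGd : HasDerivAt G (‖c₁‖ ^ 2 * a + ‖c₂‖ ^ 2 * c +
      2 * (starRingEnd ℂ c₁ * c₂ * (b + Complex.I / 2)).re) 0 := by
    have he : ∀ k : ℝ, HasDerivAt (fun h : ℝ => 2 - 2 * Real.exp (-k * h / 2)) k 0 := by
      intro k
      have := (((((hasDerivAt_id (0 : ℝ)).const_mul (-k)).div_const 2).exp).const_mul 2).const_sub 2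
      refine HasDerivAt.congr_deriv (f := fun h : ℝ => 2 - 2 * Real.exp (-k * h / 2)) this ?_
      simp
      ring
    have hr : HasDerivAt (fun h => (starRingEnd ℂ c₁ * c₂ * Z h).re)
        ((starRingEnd ℂ c₁ * c₂ * (b + Complex.I / 2)).re) 0 :=
      Complex.reCLM.hasFDerivAt.comp_hasDerivAt (0 : ℝ) (hZd.const_mul _)
    exact (((he a).const_mul _).add ((he c).const_mul _)).add (hr.const_mul 2)
  refine deriv_nonneg_of_nonneg hGd ?_ hpos
  simp [hG, hZ]

theorem IsGaussianState.uncertainty {ρ : L2 →L[ℂ] L2} {μ : Fin 2 → ℝ}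
    {C : Matrix (Fin 2) (Fin 2) ℝ} (hρ : IsGaussianState ρ μ C) :
    0 < C 0 0 ∧ C 0 1 ^ 2 + 1 / 4 ≤ C 0 0 * C 1 1 := by
  set a := C 0 0
  set b := C 0 1
  set c := C 1 1
  have key : ∀ s t : ℝ, 0 ≤ s ^ 2 * (b ^ 2 + 1 / 4) * a + t ^ 2 * c -
      2 * s * t * (b ^ 2 + 1 / 4) := by
    intro s t
    -- Choosing c₁ proportional to b + i/2 makes the cross term real and equal to −st |b + i/2|²,
    -- where |b + i/2|² = b² + 1/4.
    have h := hρ.quantumCov_nonneg (-s * (b + Complex.I / 2)) t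
    have e : ‖-(s : ℂ) * (b + Complex.I / 2)‖ ^ 2 = s ^ 2 * (b ^ 2 + 1 / 4) := by
      rw [← Complex.normSq_eq_norm_sq, Complex.normSq_apply]
      simp
      ring
    have e' : (starRingEnd ℂ (-(s : ℂ) * (b + Complex.I / 2)) * t * (b + Complex.I / 2)).re =
        -(s * t * (b ^ 2 + 1 / 4)) := by
      simp [Complex.conj_ofNat, b]
      ring
    rw [e, e', Complex.norm_real, Real.norm_eq_abs, sq_abs] at h
    linarith
  have ha0 : 0 ≤ a := by
    have := key 1 0
    nlinarith [sq_nonneg b]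
  have hb : 0 < b ^ 2 + 1 / 4 := by positivity
  have ha : 0 < a := by
    rcases ha0.lt_or_eq with h | h
    · exact h
    -- If a = 0, the form is linear in s, and this value of s makes it equal to c − (c + 1) = −1.
    · have := key ((c + 1) / (2 * (b ^ 2 + 1 / 4))) 1
      rw [← h] at this
      field_simp at this
      linarith
  refine ⟨ha, ?_⟩
  -- At (1, a) the form equals a(ac − b² − 1/4).
  have := key 1 a
  nlinarith

end QuantumDuffing

end

noncomputable section

namespace QuantumDuffing

open ProbabilityTheory
open scoped NNReal

/-! ### Gaussian moments -/

theorem integrable_pow_gaussianReal (v : ℝ≥0) (k : ℕ) :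
    Integrable (fun x : ℝ => x ^ k) (gaussianReal 0 v) := by
  rcases eq_or_ne k 0 with rfl | hk
  · simp
  have h := (memLp_id_gaussianReal' (μ := 0) (v := v) k (by simp)).integrable_norm_pow hk
  refine h.mono' (by fun_prop) (Filter.Eventually.of_forall fun x => ?_)
  simp

/-- The moments of the centered Gaussian law. -/
def gaussMoment (v : ℝ≥0) (k : ℕ) : ℝ := ∫ x, x ^ k ∂gaussianReal 0 v

theorem gaussMoment_zero (v : ℝ≥0) : gaussMoment v 0 = 1 := by simp [gaussMoment]

theorem gaussMoment_one (v : ℝ≥0) : gaussMoment v 1 = 0 := by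
  simp [gaussMoment, integral_id_gaussianReal]

theorem integrable_gaussianPDFReal_mul_pow {v : ℝ≥0} (hv : v ≠ 0) (k : ℕ) :
    Integrable (fun x : ℝ => gaussianPDFReal 0 v x * x ^ k) := by
  have h := integrable_pow_gaussianReal v k
  rw [gaussianReal_of_var_ne_zero _ hv, integrable_withDensity_iff_integrable_smul'
    (measurable_gaussianPDF _ _) (ae_of_all _ fun _ => gaussianPDF_lt_top)] at h
  simpa only [toReal_gaussianPDF, smul_eq_mul] using h

/-- Integration by parts: the density φ satisfies φ′ = −(x/v) φ, and the derivative of φ xᵏ⁺¹ has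
integral zero. For v = 0 the law is a point mass and both sides vanish. -/
theorem gaussMoment_add_two (v : ℝ≥0) (k : ℕ) :
    gaussMoment v (k + 2) = (k + 1) * v * gaussMoment v k := by
  rcases eq_or_ne v 0 with rfl | hv
  · simp [gaussMoment, gaussianReal_zero_var]
  have hv' : (v : ℝ) ≠ 0 := by exact_mod_cast hv
  have hpdf : ∀ x, HasDerivAt (gaussianPDFReal 0 v) (gaussianPDFReal 0 v x * (-x / v)) x := by
    intro x
    have h1 : HasDerivAt (fun y : ℝ => -(y - 0) ^ 2 / (2 * v)) (-x / v) x := by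
      have := ((((hasDerivAt_id x).sub_const 0).pow 2).neg.div_const (2 * (v : ℝ)))
      refine HasDerivAt.congr_deriv (f := fun y : ℝ => -(y - 0) ^ 2 / (2 * v)) this ?_
      simp
      field_simp
    have := h1.exp.const_mul (√(2 * Real.pi * v))⁻¹
    rw [gaussianPDFReal_def]
    refine this.congr_deriv ?_
    ring
  have h1 := integrable_gaussianPDFReal_mul_pow hv k
  have h2 := integrable_gaussianPDFReal_mul_pow hv (k + 1)
  have h3 := integrable_gaussianPDFReal_mul_pow hv (k + 2)
  have key := integral_eq_zero_of_hasDerivAt_of_integrable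
    (f := fun x => gaussianPDFReal 0 v x * x ^ (k + 1))
    (f' := fun x => (k + 1) * (gaussianPDFReal 0 v x * x ^ k) -
      (v : ℝ)⁻¹ * (gaussianPDFReal 0 v x * x ^ (k + 2)))
    (fun x => by
      refine ((hpdf x).mul (hasDerivAt_pow (k + 1) x)).congr_deriv ?_
      push_cast
      field_simp
      ring)
    ((h1.const_mul _).sub (h3.const_mul _)) h2
  rw [integral_sub (h1.const_mul _) (h3.const_mul _), integral_const_mul, integral_const_mul] at key
  simp only [gaussMoment, integral_gaussianReal_eq_integral_smul hv, smul_eq_mul]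
  field_simp at key
  linarith

/-- Complex z is required: the Weyl elements of a packet lead to the exponent i(u₀ + z u₁) with a
nonreal packet parameter. -/
theorem integral_exp_gaussianReal (v : ℝ≥0) (z : ℂ) :
    ∫ x : ℝ, Complex.exp (z * x) ∂gaussianReal 0 v = Complex.exp (v * z ^ 2 / 2) := by
  have := complexMGF_id_gaussianReal (μ := 0) (v := v) z
  simpa [complexMGF] using this

/-! ### Polynomials in two Gaussian variables -/

/-- Polynomials in the centered position and the centered momentum shift. -/
abbrev Symb : Type := MvPolynomial (Fin 2) ℂ

open MvPolynomial in
theorem symb_induction {p : Symb → Prop} (P : Symb)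
    (mono : ∀ (c : ℂ) (k j : ℕ), p (C c * X 0 ^ k * X 1 ^ j))
    (add : ∀ P Q, p P → p Q → p (P + Q)) : p P := by
  refine MvPolynomial.induction_on' P (fun u c => ?_) add
  rw [MvPolynomial.monomial_eq, Finsupp.prod_fintype _ _ (by simp), Fin.prod_univ_two, ← mul_assoc]
  exact mono c _ _

/-- The value of a symbol. -/
def evalSymb (P : Symb) (y s : ℝ) : ℂ := MvPolynomial.eval ![(y : ℂ), (s : ℂ)] P

@[simp] theorem evalSymb_add (P Q : Symb) (y s : ℝ) :
    evalSymb (P + Q) y s = evalSymb P y s + evalSymb Q y s := map_add _ _ _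

@[simp] theorem evalSymb_mul (P Q : Symb) (y s : ℝ) :
    evalSymb (P * Q) y s = evalSymb P y s * evalSymb Q y s := map_mul _ _ _

@[simp] theorem evalSymb_smul (c : ℂ) (P : Symb) (y s : ℝ) :
    evalSymb (c • P) y s = c * evalSymb P y s := MvPolynomial.smul_eval _ _ _

@[simp] theorem evalSymb_pow (P : Symb) (n : ℕ) (y s : ℝ) :
    evalSymb (P ^ n) y s = evalSymb P y s ^ n := map_pow _ _ _

@[simp] theorem evalSymb_zero (y s : ℝ) : evalSymb 0 y s = 0 := map_zero _

@[simp] theorem evalSymb_one (y s : ℝ) : evalSymb 1 y s = 1 := map_one _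

@[simp] theorem evalSymb_C (c : ℂ) (y s : ℝ) : evalSymb (MvPolynomial.C c) y s = c :=
  MvPolynomial.eval_C _

@[simp] theorem evalSymb_X_zero (y s : ℝ) : evalSymb (MvPolynomial.X 0) y s = y := by
  simp [evalSymb]

@[simp] theorem evalSymb_X_one (y s : ℝ) : evalSymb (MvPolynomial.X 1) y s = s := by
  simp [evalSymb]

theorem continuous_evalSymb (P : Symb) : Continuous fun p : ℝ × ℝ => evalSymb P p.1 p.2 := by
  induction P using symb_induction with
  | mono c k j => simp only [evalSymb_mul, evalSymb_pow, evalSymb_C, evalSymb_X_zero,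
      evalSymb_X_one]; fun_prop
  | add P Q hP hQ => simp only [evalSymb_add]; exact hP.add hQ

theorem hasDerivAt_evalSymb (P : Symb) (y s : ℝ) :
    HasDerivAt (fun y => evalSymb P y s) (evalSymb (MvPolynomial.pderiv 0 P) y s) y := by
  induction P using MvPolynomial.induction_on with
  | C c =>
    simp only [evalSymb_C, MvPolynomial.pderiv_C, evalSymb_zero]
    exact hasDerivAt_const y c
  | add P Q hP hQ => simp only [evalSymb_add, map_add]; exact hP.add hQ
  | mul_X P i hP =>
    have hX : HasDerivAt (fun y => evalSymb (MvPolynomial.X i) y s)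
        (evalSymb (MvPolynomial.pderiv 0 (MvPolynomial.X i)) y s) y := by
      fin_cases i
      · simpa using (hasDerivAt_id y).ofReal_comp
      · have : MvPolynomial.pderiv (0 : Fin 2) (MvPolynomial.X 1 : Symb) = MvPolynomial.C 0 := by
          rw [MvPolynomial.pderiv_X_of_ne (by decide), map_zero]
        simp only [Fin.mk_one, this, evalSymb_C, evalSymb_X_one]
        exact hasDerivAt_const y _
    simp only [evalSymb_mul, MvPolynomial.pderiv_mul, evalSymb_add]
    exact hP.mul hX

/-- The joint law of the two Gaussian variables. -/
def gaussLaw (a d : ℝ≥0) : Measure (ℝ × ℝ) := (gaussianReal 0 a).prod (gaussianReal 0 d)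

theorem integrable_evalSymb (a d : ℝ≥0) (P : Symb) :
    Integrable (fun p : ℝ × ℝ => evalSymb P p.1 p.2) (gaussLaw a d) := by
  induction P using symb_induction with
  | mono c k j =>
    have h1 := ((integrable_pow_gaussianReal a k).ofReal (𝕜 := ℂ)).const_mul c
    have h2 := (integrable_pow_gaussianReal d j).ofReal (𝕜 := ℂ)
    simpa [gaussLaw] using h1.mul_prod h2
  | add P Q hP hQ => simp only [evalSymb_add]; exact hP.add hQ

/-- The expectation of a polynomial in the two Gaussian variables. -/
def gaussE (a d : ℝ≥0) : Symb →ₗ[ℂ] ℂ where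
  toFun P := ∫ p, evalSymb P p.1 p.2 ∂gaussLaw a d
  map_add' P Q := by
    simp only [evalSymb_add]
    exact integral_add (integrable_evalSymb a d P) (integrable_evalSymb a d Q)
  map_smul' c P := by
    simp only [evalSymb_smul, integral_const_mul, RingHom.id_apply, smul_eq_mul]

theorem gaussE_apply (a d : ℝ≥0) (P : Symb) :
    gaussE a d P = ∫ p, evalSymb P p.1 p.2 ∂gaussLaw a d := rfl

theorem gaussE_eq_integral_integral (a d : ℝ≥0) (P : Symb) :
    gaussE a d P = ∫ s, ∫ y, evalSymb P y s ∂gaussianReal 0 a ∂gaussianReal 0 d :=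
  integral_prod_symm _ (integrable_evalSymb a d P)

theorem gaussE_monomial (a d : ℝ≥0) (k j : ℕ) :
    gaussE a d (MvPolynomial.X 0 ^ k * MvPolynomial.X 1 ^ j) =
      ((gaussMoment a k * gaussMoment d j : ℝ) : ℂ) := by
  rw [gaussE_apply, gaussLaw]
  simp only [evalSymb_mul, evalSymb_pow, evalSymb_X_zero, evalSymb_X_one]
  rw [integral_prod_mul (fun y : ℝ => (y : ℂ) ^ k) (fun s : ℝ => (s : ℂ) ^ j)]
  simp only [gaussMoment, ← Complex.ofReal_pow, integral_complex_ofReal, Complex.ofReal_mul]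

theorem gaussE_C_mul (a d : ℝ≥0) (c : ℂ) (P : Symb) :
    gaussE a d (MvPolynomial.C c * P) = c * gaussE a d P := by
  rw [← MvPolynomial.smul_eq_C_mul, map_smul, smul_eq_mul]

/-- Integration by parts in the first variable. -/
theorem gaussE_X_mul (a d : ℝ≥0) (P : Symb) :
    gaussE a d (MvPolynomial.X 0 * P) = a * gaussE a d (MvPolynomial.pderiv 0 P) := by
  induction P using symb_induction with
  | mono c k j =>
    have h1 : MvPolynomial.pderiv (0 : Fin 2) (MvPolynomial.X 1 : Symb) = 0 :=
      MvPolynomial.pderiv_X_of_ne (by decide)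
    have e1 : (MvPolynomial.X 0 * (MvPolynomial.C c * MvPolynomial.X 0 ^ k * MvPolynomial.X 1 ^ j) :
        Symb) = MvPolynomial.C c * (MvPolynomial.X 0 ^ (k + 1) * MvPolynomial.X 1 ^ j) := by ring
    -- For k = 0 the truncated exponent `k - 1` is harmless, since the coefficient c k vanishes.
    have e2 : MvPolynomial.pderiv (0 : Fin 2) (MvPolynomial.C c * MvPolynomial.X 0 ^ k *
        MvPolynomial.X 1 ^ j : Symb) = MvPolynomial.C (c * k) *
          (MvPolynomial.X 0 ^ (k - 1) * MvPolynomial.X 1 ^ j) := by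
      simp only [MvPolynomial.pderiv_mul, MvPolynomial.pderiv_C, MvPolynomial.pderiv_pow,
        MvPolynomial.pderiv_X_self, h1, MvPolynomial.C_mul]
      simp
      ring
    rw [e1, e2, gaussE_C_mul, gaussE_C_mul, gaussE_monomial, gaussE_monomial]
    cases k with
    | zero => simp [gaussMoment_one]
    | succ k =>
      rw [gaussMoment_add_two, Nat.add_sub_cancel]
      push_cast
      ring
  | add P Q hP hQ => simp only [mul_add, map_add, hP, hQ]

/-- The complex conjugate of a symbol. -/
def conjSymb : Symb →+* Symb := MvPolynomial.map (starRingEnd ℂ)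

theorem evalSymb_conj (P : Symb) (y s : ℝ) :
    evalSymb (conjSymb P) y s = starRingEnd ℂ (evalSymb P y s) := by
  induction P using MvPolynomial.induction_on with
  | C c => simp [conjSymb]
  | add P Q hP hQ => simp only [map_add, evalSymb_add, hP, hQ]
  | mul_X P i hP =>
    simp only [map_mul, evalSymb_mul, hP]
    congr 1
    fin_cases i <;> simp [conjSymb]

theorem gaussE_conj (a d : ℝ≥0) (P : Symb) :
    gaussE a d (conjSymb P) = starRingEnd ℂ (gaussE a d P) := by
  simp only [gaussE_apply, evalSymb_conj, integral_conj]

theorem pderiv_conj (P : Symb) :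
    MvPolynomial.pderiv 0 (conjSymb P) = conjSymb (MvPolynomial.pderiv 0 P) := by
  induction P using MvPolynomial.induction_on with
  | C c => simp [conjSymb]
  | add P Q hP hQ => simp only [map_add, hP, hQ]
  | mul_X P i hP =>
    simp only [map_mul, MvPolynomial.pderiv_mul, hP, map_add]
    congr 2
    fin_cases i
    · simp [conjSymb]
    · simp [conjSymb, MvPolynomial.pderiv_X_of_ne (show (1 : Fin 2) ≠ 0 by decide)]

end QuantumDuffing

end

noncomputable section

namespace QuantumDuffing

open ProbabilityTheory
open scoped NNReal

/-! ### Gaussian wave packets -/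

/-- The parameters of a mixture of Gaussian wave packets: the variance `a` of the position, the
covariance `b` of position and momentum, the variance `d` of the random momentum shift and the mean
vector. -/
structure PacketParam where
  a : ℝ≥0
  a_ne : a ≠ 0
  b : ℝ
  d : ℝ≥0
  mean : Fin 2 → ℝ

namespace PacketParam

variable (G : PacketParam)

/-- The complex number `z` for which the wave packets are multiples of `exp (i z y² / 2 + …)`. -/
def z : ℂ := (G.b + Complex.I / 2) / (G.a : ℝ)

theorem a_pos : (0 : ℝ) < G.a := by
  have := G.a_ne
  positivity

theorem a_mul_z : ((G.a : ℝ) : ℂ) * G.z = G.b + Complex.I / 2 := by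
  have : ((G.a : ℝ) : ℂ) ≠ 0 := by exact_mod_cast G.a_pos.ne'
  rw [z]
  field_simp

/-- The wave packet with momentum shift `s`, as a function of the centered position. -/
def wave (s y : ℝ) : ℂ := (√((√(2 * Real.pi * G.a))⁻¹) : ℝ) *
  Complex.exp (Complex.I * (G.z * y ^ 2 / 2 + (G.mean 1 + s) * y))

/-- Since Im z = 1/(2a), the quadratic exponents combine to −y²/(2a), the Gaussian density of
variance a. The case t = 0 gives |ψ_s|², and general t gives the Weyl matrix elements. -/
theorem conj_wave_mul_wave (s y t : ℝ) : starRingEnd ℂ (G.wave s y) * G.wave s (y + t) =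
    gaussianPDFReal 0 G.a y * Complex.exp (Complex.I *
      (G.z * y * t + G.z * t ^ 2 / 2 + (G.mean 1 + s) * t)) := by
  have ha : ((G.a : ℝ) : ℂ) ≠ 0 := by exact_mod_cast G.a_pos.ne'
  have h2 : ((√((√(2 * Real.pi * G.a))⁻¹) : ℝ) : ℂ) * (√((√(2 * Real.pi * G.a))⁻¹) : ℝ) =
      ((√(2 * Real.pi * G.a))⁻¹ : ℝ) := by
    rw [← Complex.ofReal_mul, Real.mul_self_sqrt (by positivity)]
  have hz : starRingEnd ℂ G.z = (G.b - Complex.I / 2) / (G.a : ℝ) := by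
    simp [z, Complex.conj_ofNat]
    ring
  simp only [wave, gaussianPDFReal, map_mul, Complex.conj_ofReal, ← Complex.exp_conj,
    Complex.conj_I, map_add, map_div₀, hz, map_pow, Complex.conj_ofNat]
  rw [Complex.ofReal_mul, ← h2, Complex.ofReal_exp]
  rw [show ∀ N A B : ℂ, N * A * (N * B) = N * N * (A * B) from fun _ _ _ => by ring,
    mul_assoc (_ * _)]
  congr 1
  rw [← Complex.exp_add, ← Complex.exp_add]
  congr 1
  rw [z]
  push_cast
  field_simp
  ring_nf
  simp only [Complex.I_sq]
  ring

theorem norm_wave_sq (s y : ℝ) : ‖G.wave s y‖ ^ 2 = gaussianPDFReal 0 G.a y := by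
  have h := G.conj_wave_mul_wave s y 0
  rw [add_zero, Complex.conj_mul'] at h
  have : Complex.exp (Complex.I * (G.z * y * (0 : ℝ) + G.z * (0 : ℝ) ^ 2 / 2 +
      (G.mean 1 + s) * (0 : ℝ))) = 1 := by simp
  rw [this, mul_one] at h
  exact_mod_cast h

theorem norm_wave_eq (s t y : ℝ) : ‖G.wave s y‖ = ‖G.wave t y‖ := by
  have h := (G.norm_wave_sq s y).trans (G.norm_wave_sq t y).symm
  exact (pow_left_inj₀ (norm_nonneg _) (norm_nonneg _) two_ne_zero).1 h

theorem continuous_wave (s : ℝ) : Continuous (G.wave s) := by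
  unfold wave
  fun_prop

theorem wave_shift (s t y : ℝ) :
    G.wave s y = Complex.exp (Complex.I * (((s - t) * y : ℝ) : ℂ)) * G.wave t y := by
  rw [wave, wave, mul_left_comm, ← Complex.exp_add]
  congr 2
  push_cast
  ring

theorem hasDerivAt_wave (s y : ℝ) : HasDerivAt (G.wave s)
    (Complex.I * (G.z * y + G.mean 1 + s) * G.wave s y) y := by
  have hy : HasDerivAt (fun y : ℝ => (y : ℂ)) 1 y := (hasDerivAt_id y).ofReal_comp
  have h1 : HasDerivAt (fun y : ℝ => Complex.I * (G.z * (y : ℂ) ^ 2 / 2 + (G.mean 1 + s) * y))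
      (Complex.I * (G.z * y + G.mean 1 + s)) y := by
    have := ((((hy.pow 2).const_mul G.z).div_const 2).add
      (hy.const_mul ((G.mean 1 : ℂ) + s))).const_mul Complex.I
    refine this.congr_deriv ?_
    simp
    ring
  refine (h1.cexp.const_mul _).congr_deriv ?_
  rw [wave]
  ring

/-- The product of the wave packet with a polynomial, as a function of the position. -/
def vecFun (P : Symb) (s x : ℝ) : ℂ :=
  evalSymb P (x - G.mean 0) s * G.wave s (x - G.mean 0)

theorem continuous_vecFun (P : Symb) (s : ℝ) : Continuous (G.vecFun P s) := by
  have h1 : Continuous fun x : ℝ => evalSymb P (x - G.mean 0) s :=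
    (continuous_evalSymb P).comp (f := fun x : ℝ => (x - G.mean 0, s)) (by fun_prop)
  exact h1.mul ((G.continuous_wave s).comp (by fun_prop))

theorem memLp_vecFun (P : Symb) (s : ℝ) : MemLp (G.vecFun P s) 2 volume := by
  induction P using symb_induction with
  | mono c k j =>
    refine (memLp_two_iff_integrable_sq_norm
      (G.continuous_vecFun _ s).aestronglyMeasurable).2 ?_
    have h := ((integrable_gaussianPDFReal_mul_pow G.a_ne (2 * k)).const_mul
      (‖c‖ ^ 2 * |s| ^ (2 * j))).comp_sub_right (G.mean 0)
    refine h.congr (Filter.Eventually.of_forall fun x => ?_)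
    simp only [vecFun, evalSymb_mul, evalSymb_pow, evalSymb_C, evalSymb_X_zero, evalSymb_X_one,
      norm_mul, norm_pow, mul_pow, norm_wave_sq, Complex.norm_real, Real.norm_eq_abs]
    rw [← pow_mul, ← pow_mul, mul_comm k, mul_comm j, (even_two_mul k).pow_abs]
    ring
  | add P Q hP hQ =>
    refine (hP.add hQ).ae_eq (Filter.Eventually.of_forall fun x => ?_)
    simp only [vecFun, evalSymb_add, Pi.add_apply, add_mul]

/-- The product of the wave packet with a polynomial, as an element of `L²(ℝ)`. -/
def vec (P : Symb) (s : ℝ) : L2 := (G.memLp_vecFun P s).toLp _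

theorem coeFn_vec (P : Symb) (s : ℝ) : G.vec P s =ᵐ[volume] G.vecFun P s := MemLp.coeFn_toLp _

theorem vec_add (P Q : Symb) (s : ℝ) : G.vec (P + Q) s = G.vec P s + G.vec Q s := by
  rw [vec, vec, vec, ← MemLp.toLp_add]
  refine MemLp.toLp_congr _ _ (Filter.Eventually.of_forall fun x => ?_)
  simp only [vecFun, evalSymb_add, Pi.add_apply, add_mul]

theorem vec_smul (c : ℂ) (P : Symb) (s : ℝ) : G.vec (c • P) s = c • G.vec P s := by
  rw [vec, vec, ← MemLp.toLp_const_smul]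
  refine MemLp.toLp_congr _ _ (Filter.Eventually.of_forall fun x => ?_)
  simp only [vecFun, evalSymb_smul, Pi.smul_apply, smul_eq_mul, mul_assoc]

/-- The powers of s are scalars, so continuity and growth in s need to be studied only for powers of
the position. -/
theorem vec_mono (c : ℂ) (k j : ℕ) (s : ℝ) :
    G.vec (MvPolynomial.C c * MvPolynomial.X 0 ^ k * MvPolynomial.X 1 ^ j) s =
      (c * (s : ℂ) ^ j) • G.vec (MvPolynomial.X 0 ^ k) s := by
  rw [vec, vec, ← MemLp.toLp_const_smul]
  refine MemLp.toLp_congr _ _ (Filter.Eventually.of_forall fun x => ?_)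
  simp only [vecFun, evalSymb_mul, evalSymb_pow, evalSymb_C, evalSymb_X_zero, evalSymb_X_one,
    Pi.smul_apply, smul_eq_mul]
  ring

theorem norm_vec_pow (k : ℕ) (s t : ℝ) :
    ‖G.vec (MvPolynomial.X 0 ^ k) s‖ = ‖G.vec (MvPolynomial.X 0 ^ k) t‖ := by
  rw [vec, vec, Lp.norm_toLp, Lp.norm_toLp]
  congr 1
  refine eLpNorm_congr_norm_ae (Filter.Eventually.of_forall fun x => ?_)
  simp only [vecFun, evalSymb_pow, evalSymb_X_zero, norm_mul, G.norm_wave_eq s t]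

/-- Changing s multiplies the packet by a phase, and |exp(i(s − t)y) − 1| ≤ |s − t||y|. The extra
factor |y| raises the power by one, so the norm of the next power, which is independent of s, is a
Lipschitz constant. -/
theorem continuous_vec_pow (k : ℕ) : Continuous (G.vec (MvPolynomial.X 0 ^ k)) := by
  refine LipschitzWith.continuous
    (K := ‖G.vec (MvPolynomial.X 0 ^ (k + 1)) 0‖₊)
    (LipschitzWith.of_dist_le_mul fun s t => ?_)
  rw [dist_eq_norm, Real.dist_eq, coe_nnnorm, G.norm_vec_pow (k + 1) 0 t, mul_comm]
  refine Lp.norm_le_mul_norm_of_ae_le_mul ?_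
  filter_upwards [Lp.coeFn_sub (G.vec (MvPolynomial.X 0 ^ k) s) (G.vec (MvPolynomial.X 0 ^ k) t),
    G.coeFn_vec (MvPolynomial.X 0 ^ k) s, G.coeFn_vec (MvPolynomial.X 0 ^ k) t,
    G.coeFn_vec (MvPolynomial.X 0 ^ (k + 1)) t] with x h1 h2 h3 h4
  rw [h1, Pi.sub_apply, h2, h3, h4]
  simp only [vecFun, evalSymb_pow, evalSymb_X_zero]
  set y := x - G.mean 0
  rw [G.wave_shift s t y, show ∀ A B W : ℂ, A * (B * W) - A * W = (B - 1) * (A * W) from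
    fun _ _ _ => by ring, norm_mul, norm_mul, norm_mul, norm_pow, norm_pow]
  have h5 := Real.norm_exp_I_mul_ofReal_sub_one_le (x := (s - t) * y)
  rw [norm_mul, Real.norm_eq_abs] at h5
  rw [Complex.norm_real, pow_succ]
  calc _ ≤ |s - t| * ‖y‖ * (‖y‖ ^ k * ‖G.wave t y‖) := by gcongr
    _ = _ := by ring

theorem continuous_vec_one : Continuous (G.vec 1) := by
  simpa using G.continuous_vec_pow 0

theorem norm_vec_one (s t : ℝ) : ‖G.vec 1 s‖ = ‖G.vec 1 t‖ := by
  simpa using G.norm_vec_pow 0 s t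

/-- For a monomial symbol the integrand is continuous in s and its norm is a constant times a power
of |s|, which has finite Gaussian moments. -/
theorem integrable_rankOne (P : Symb) :
    Integrable (fun s => (InnerProductSpace.rankOne ℂ (G.vec P s) (G.vec 1 s) : L2 →L[ℂ] L2))
      (gaussianReal 0 G.d) := by
  induction P using symb_induction with
  | mono c k j =>
    have hcont : Continuous fun s =>
        (InnerProductSpace.rankOne ℂ (G.vec (MvPolynomial.C c * MvPolynomial.X 0 ^ k *
          MvPolynomial.X 1 ^ j) s) (G.vec 1 s) : L2 →L[ℂ] L2) := by
      simp only [vec_mono]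
      have h1 := G.continuous_vec_pow k
      have h2 := G.continuous_vec_one
      have h3 : Continuous fun s : ℝ => (c * (s : ℂ) ^ j) • G.vec (MvPolynomial.X 0 ^ k) s := by
        fun_prop
      exact (ContinuousLinearMap.smulRightL ℂ L2 L2).continuous₂.comp
        (((innerSL ℂ).continuous.comp h2).prodMk h3)
    refine (((integrable_pow_gaussianReal G.d j).norm.const_mul
      (‖c‖ * ‖G.vec (MvPolynomial.X 0 ^ k) 0‖ * ‖G.vec 1 0‖))).mono' hcont.aestronglyMeasurable
      (Filter.Eventually.of_forall fun s => ?_)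
    rw [InnerProductSpace.norm_rankOne, vec_mono, norm_smul, norm_mul, norm_pow, norm_pow,
      Complex.norm_real, G.norm_vec_pow k s 0, G.norm_vec_one s 0]
    exact le_of_eq (by ring)
  | add P Q hP hQ =>
    simp only [vec_add, map_add, _root_.add_apply]
    exact hP.add hQ

/-- The superposition of the operators `|P ψ_s⟩⟨ψ_s|`, where `ψ_s` are the wave packets. -/
def superposition : Symb →ₗ[ℂ] L2 →L[ℂ] L2 where
  toFun P := ∫ s, InnerProductSpace.rankOne ℂ (G.vec P s) (G.vec 1 s) ∂gaussianReal 0 G.d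
  map_add' P Q := by
    simp only [vec_add, map_add, _root_.add_apply]
    exact integral_add (G.integrable_rankOne P) (G.integrable_rankOne Q)
  map_smul' c P := by
    simp only [vec_smul, map_smul, _root_.smul_apply, RingHom.id_apply]
    exact integral_smul c _

theorem superposition_eq (P : Symb) : G.superposition P =
    ∫ s, InnerProductSpace.rankOne ℂ (G.vec P s) (G.vec 1 s) ∂gaussianReal 0 G.d := rfl

theorem inner_superposition (P : Symb) (χ φ : L2) : inner ℂ χ (G.superposition P φ) =
    ∫ s, inner ℂ (G.vec 1 s) φ * inner ℂ χ (G.vec P s) ∂gaussianReal 0 G.d := by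
  have h := G.integrable_rankOne P
  rw [superposition_eq, ContinuousLinearMap.integral_apply h,
    ← integral_inner (h.apply_continuousLinearMap φ)]
  simp only [InnerProductSpace.rankOne_apply, inner_smul_right]

theorem inner_vec_one_vec (P : Symb) (s : ℝ) :
    inner ℂ (G.vec 1 s) (G.vec P s) = ∫ y, evalSymb P y s ∂gaussianReal 0 G.a := by
  rw [L2.inner_def, integral_gaussianReal_eq_integral_smul G.a_ne]
  symm
  rw [← integral_sub_right_eq_self _ (G.mean 0)]
  refine integral_congr_ae ?_
  filter_upwards [G.coeFn_vec 1 s, G.coeFn_vec P s] with x h1 h2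
  have h3 := G.norm_wave_sq s (x - G.mean 0)
  rw [h1, h2, ← h3]
  simp only [vecFun, evalSymb_one, one_mul, RCLike.inner_apply, Complex.real_smul]
  rw [mul_assoc, Complex.mul_conj']
  push_cast
  ring

/-- For every s the density |ψ_s|² is the same Gaussian, so position and shift are independent under
the trace. -/
theorem hasTrace_superposition (P : Symb) :
    HasTrace (G.superposition P) (gaussE G.a G.d P) := by
  rw [gaussE_eq_integral_integral]
  simp only [← inner_vec_one_vec]
  exact hasTrace_integral_rankOne (G.integrable_rankOne P)

theorem isPositive_superposition_one : (G.superposition 1).IsPositive := by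
  rw [ContinuousLinearMap.isPositive_iff_complex]
  intro φ
  have h : inner ℂ (G.superposition 1 φ) φ =
      ((∫ s, ‖inner ℂ (G.vec 1 s) φ‖ ^ 2 ∂gaussianReal 0 G.d : ℝ) : ℂ) := by
    rw [← inner_conj_symm, inner_superposition, ← integral_complex_ofReal, ← integral_conj]
    refine integral_congr_ae (Filter.Eventually.of_forall fun s => ?_)
    simp only
    rw [← inner_conj_symm φ, Complex.mul_conj']
    simp
  rw [h]
  exact ⟨by simp, integral_nonneg fun s => by positivity⟩

end PacketParam

end QuantumDuffing

end

noncomputable section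

namespace QuantumDuffing

open ProbabilityTheory
open scoped NNReal

/-! ### Action of position, momentum and Weyl operators on the superpositions -/

theorem HasWeakDeriv.mem_momentum {ψ φ : L2} (h : HasWeakDeriv ψ φ) :
    ∃ hψ : ψ ∈ momentum.domain, momentum ⟨ψ, hψ⟩ = (-Complex.I) • φ := by
  have hψ : ψ ∈ momentum.domain := ⟨φ, h⟩
  refine ⟨hψ, ?_⟩
  change (-Complex.I) • Classical.choose hψ = _
  rw [(Classical.choose_spec hψ).unique h]

theorem mem_position_of_ae_eq {ψ φ : L2} (h : (fun x : ℝ => (x : ℂ) * ψ x) =ᵐ[volume] φ) :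
    ∃ hψ : ψ ∈ position.domain, position ⟨ψ, hψ⟩ = φ := by
  have hψ : MemLp (fun x : ℝ => (x : ℂ) * ψ x) 2 volume := (memLp_congr_ae h).2 (Lp.memLp φ)
  refine ⟨hψ, ?_⟩
  change MemLp.toLp _ hψ = φ
  rw [MemLp.toLp_congr hψ (Lp.memLp φ) h, Lp.toLp_coeFn]

namespace PacketParam

variable (G : PacketParam)

/-- The action of the position operator on the symbols. -/
def posSymb : Symb →ₗ[ℂ] Symb :=
  LinearMap.mulLeft ℂ (MvPolynomial.X 0 + MvPolynomial.C (G.mean 0 : ℂ))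

/-- The logarithmic derivative of the wave packets. -/
def logDeriv : Symb := MvPolynomial.C Complex.I *
  (MvPolynomial.C G.z * MvPolynomial.X 0 + MvPolynomial.C (G.mean 1 : ℂ) + MvPolynomial.X 1)

/-- The action of the derivative on the symbols. -/
def derivSymb : Symb →ₗ[ℂ] Symb :=
  (MvPolynomial.pderiv (R := ℂ) (0 : Fin 2)).toLinearMap + LinearMap.mulLeft ℂ G.logDeriv

/-- The action of the momentum operator on the symbols. -/
def momSymb : Symb →ₗ[ℂ] Symb := (-Complex.I) • G.derivSymb

theorem hasDerivAt_vecFun (P : Symb) (s x : ℝ) :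
    HasDerivAt (G.vecFun P s) (G.vecFun (G.derivSymb P) s x) x := by
  have h := ((hasDerivAt_evalSymb P (x - G.mean 0) s).mul
    (G.hasDerivAt_wave s (x - G.mean 0))).comp_sub_const x (G.mean 0)
  refine HasDerivAt.congr_deriv (f := G.vecFun P s) h ?_
  simp only [vecFun, derivSymb, logDeriv, LinearMap.add_apply, LinearMap.mulLeft_apply,
    evalSymb_add, evalSymb_mul, evalSymb_C, evalSymb_X_zero, evalSymb_X_one,
    Derivation.coeFn_coe]
  ring

theorem inner_testVec_vec {g : ℝ → ℝ} (hg : Continuous g) (hs : HasCompactSupport g) (P : Symb)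
    (s : ℝ) : inner ℂ (testVec hg hs) (G.vec P s) = ∫ x, (g x : ℂ) * G.vecFun P s x := by
  rw [inner_testVec]
  refine integral_congr_ae ?_
  filter_upwards [G.coeFn_vec P s] with x hx
  rw [hx, Complex.real_smul]

theorem inner_testVec_deriv_vec {g : ℝ → ℝ} (hg : ContDiff ℝ ∞ g) (hs : HasCompactSupport g)
    (P : Symb) (s : ℝ) :
    inner ℂ (testVec (hg.continuous_deriv (by simp)) hs.deriv) (G.vec P s) =
      -inner ℂ (testVec hg.continuous hs) (G.vec (G.derivSymb P) s) := by
  rw [inner_testVec_vec, inner_testVec_vec]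
  have hd : Continuous (deriv g) := hg.continuous_deriv (by simp)
  have hcs : ∀ {h : ℝ → ℝ}, HasCompactSupport h → HasCompactSupport fun x => (h x : ℂ) := fun hh =>
    hh.comp_left (g := fun x : ℝ => (x : ℂ)) Complex.ofReal_zero
  have hint : ∀ {h : ℝ → ℝ} (Q : Symb), Continuous h → HasCompactSupport h →
      Integrable (fun x => (h x : ℂ) * G.vecFun Q s x) := fun Q hc hh =>
    ((Complex.continuous_ofReal.comp hc).mul
      (G.continuous_vecFun Q s)).integrable_of_hasCompactSupport ((hcs hh).mul_right)
  have := integral_mul_deriv_eq_deriv_mul_of_integrable (u := fun x => (g x : ℂ))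
    (v := G.vecFun P s) (u' := fun x => ((deriv g x : ℝ) : ℂ))
    (v' := G.vecFun (G.derivSymb P) s)
    (fun x _ => ((hg.differentiable (by simp)) x).hasDerivAt.ofReal_comp)
    (fun x _ => G.hasDerivAt_vecFun P s x) (hint _ hg.continuous hs) (hint _ hd hs.deriv)
    (hint _ hg.continuous hs)
  rw [this, neg_neg]

/-- Pairing with a test function passes inside the integral over s, where classical integration by
parts applies to each packet. -/
theorem hasWeakDeriv_superposition (P : Symb) (φ : L2) :
    HasWeakDeriv (G.superposition P φ) (G.superposition (G.derivSymb P) φ) := by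
  intro g hg hs
  rw [← inner_testVec (hg.continuous_deriv (by simp)) hs.deriv, ← inner_testVec hg.continuous hs,
    inner_superposition, inner_superposition, ← integral_neg]
  refine integral_congr_ae (Filter.Eventually.of_forall fun s => ?_)
  simp only
  rw [G.inner_testVec_deriv_vec hg hs, mul_neg]

theorem intertwines_momentum : Intertwines G.superposition momentum G.momSymb := by
  intro P φ
  obtain ⟨h, e⟩ := (G.hasWeakDeriv_superposition P φ).mem_momentum
  refine ⟨h, ?_⟩
  rw [e, momSymb, LinearMap.smul_apply, map_smul, _root_.smul_apply]

/-- A priori x times the vector is only locally integrable. Testing identifies it almost everywhere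
with an element of L², which yields membership in the domain together with the value. -/
theorem intertwines_position : Intertwines G.superposition position G.posSymb := by
  intro P φ
  refine mem_position_of_ae_eq ?_
  have hloc : LocallyIntegrable fun x : ℝ => (x : ℂ) * G.superposition P φ x := by
    have h1 := (Lp.memLp (G.superposition P φ)).locallyIntegrable (by norm_num)
    rw [← locallyIntegrableOn_univ] at h1 ⊢
    exact h1.continuousOn_mul Complex.continuous_ofReal.continuousOn isOpen_univ.isLocallyClosed
  refine ae_eq_of_integral_contDiff_smul_eq hloc
    ((Lp.memLp _).locallyIntegrable (by norm_num)) fun g hg hs => ?_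
  have hc : Continuous fun x => g x * x := hg.continuous.mul continuous_id
  have hsx : HasCompactSupport fun x => g x * x := hs.mul_right
  have e1 : ∀ x : ℝ, g x • ((x : ℂ) * G.superposition P φ x) =
      (g x * x) • G.superposition P φ x := fun x => by
    simp only [Complex.real_smul]
    push_cast
    ring
  simp only [e1]
  rw [← inner_testVec hc hsx, ← inner_testVec hg.continuous hs, inner_superposition,
    inner_superposition]
  refine integral_congr_ae (Filter.Eventually.of_forall fun s => ?_)
  simp only [inner_testVec_vec]
  congr 1
  refine integral_congr_ae (Filter.Eventually.of_forall fun x => ?_)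
  simp only [vecFun, posSymb, LinearMap.mulLeft_apply, evalSymb_mul, evalSymb_add, evalSymb_C,
    evalSymb_X_zero]
  push_cast
  ring

/-- The expectation of the Weyl operators in a wave packet. -/
theorem inner_vec_weyl_vec (u : Fin 2 → ℝ) (s : ℝ) :
    inner ℂ (G.vec 1 s) (weyl u (G.vec 1 s)) =
      Complex.exp (Complex.I * ((u ⬝ᵥ G.mean : ℝ) : ℂ) + Complex.I * u 1 * s) *
        (Real.exp (-(G.a * u 0 ^ 2 + 2 * G.b * u 0 * u 1 +
          (G.b ^ 2 + 1 / 4) / G.a * u 1 ^ 2) / 2) : ℝ) := by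
  have ha : ((G.a : ℝ) : ℂ) ≠ 0 := by exact_mod_cast G.a_pos.ne'
  set W : ℂ := Complex.exp (Complex.I * (u 0 * G.mean 0 + u 0 * u 1 / 2 + G.z * u 1 ^ 2 / 2 +
    (G.mean 1 + s) * u 1)) with hW
  have h1 : inner ℂ (G.vec 1 s) (weyl u (G.vec 1 s)) =
      ∫ x : ℝ, gaussianPDFReal 0 G.a (x - G.mean 0) •
        (W * Complex.exp (Complex.I * (u 0 + G.z * u 1) * ((x - G.mean 0 : ℝ) : ℂ))) := by
    rw [inner_weyl]
    refine integral_congr_ae ?_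
    filter_upwards [G.coeFn_vec 1 s, (measurePreserving_add_right volume
      (u 1)).quasiMeasurePreserving.ae (G.coeFn_vec 1 s)] with x h1 h2
    rw [h1, h2]
    simp only [vecFun, evalSymb_one, one_mul]
    rw [show x + u 1 - G.mean 0 = x - G.mean 0 + u 1 by ring, conj_wave_mul_wave,
      Complex.real_smul, mul_left_comm, hW, ← Complex.exp_add, ← Complex.exp_add]
    congr 2
    push_cast
    ring
  rw [h1, integral_sub_right_eq_self (fun x : ℝ => gaussianPDFReal 0 G.a x •
    (W * Complex.exp (Complex.I * (u 0 + G.z * u 1) * (x : ℂ)))) (G.mean 0),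
    ← integral_gaussianReal_eq_integral_smul G.a_ne, integral_const_mul, integral_exp_gaussianReal,
    hW, Complex.ofReal_exp, ← Complex.exp_add, ← Complex.exp_add]
  congr 1
  rw [z]
  simp only [dotProduct, Fin.sum_univ_two]
  push_cast
  field_simp
  ring_nf
  simp only [Complex.I_sq, show Complex.I ^ 3 = -Complex.I by rw [pow_succ, Complex.I_sq]; ring,
    Complex.I_pow_four]
  ring

/-- A single packet contributes the momentum variance (b² + 1/4)/a. Averaging exp(i u₁ s) over the
shift adds d. -/
theorem hasTrace_weyl_superposition (u : Fin 2 → ℝ) :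
    HasTrace (fun ψ => weyl u (G.superposition 1 ψ))
      (Complex.exp (Complex.I * ((u ⬝ᵥ G.mean : ℝ) : ℂ)) *
        (Real.exp (-(G.a * u 0 ^ 2 + 2 * G.b * u 0 * u 1 +
          ((G.b ^ 2 + 1 / 4) / G.a + G.d) * u 1 ^ 2) / 2) : ℝ)) := by
  have hcomp : ∀ s, InnerProductSpace.rankOne ℂ (weylCLM u (G.vec 1 s)) (G.vec 1 s) =
      (ContinuousLinearMap.compL ℂ L2 L2 L2 (weylCLM u))
        (InnerProductSpace.rankOne ℂ (G.vec 1 s) (G.vec 1 s)) := fun s =>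
    (InnerProductSpace.comp_rankOne _ _ _).symm
  have hint : Integrable (fun s => (InnerProductSpace.rankOne ℂ (weylCLM u (G.vec 1 s))
      (G.vec 1 s) : L2 →L[ℂ] L2)) (gaussianReal 0 G.d) := by
    simp only [hcomp]
    exact (ContinuousLinearMap.compL ℂ L2 L2 L2 (weylCLM u)).integrable_comp
      (G.integrable_rankOne 1)
  have h := hasTrace_integral_rankOne hint
  have e1 : (∫ s, InnerProductSpace.rankOne ℂ (weylCLM u (G.vec 1 s)) (G.vec 1 s)
      ∂gaussianReal 0 G.d : L2 →L[ℂ] L2) = (weylCLM u).comp (G.superposition 1) := by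
    simp only [hcomp]
    rw [ContinuousLinearMap.integral_comp_comm _ (G.integrable_rankOne 1), superposition_eq]
    rfl
  rw [e1] at h
  have e2 : ∫ s, inner ℂ (G.vec 1 s) (weylCLM u (G.vec 1 s)) ∂gaussianReal 0 G.d =
      Complex.exp (Complex.I * ((u ⬝ᵥ G.mean : ℝ) : ℂ)) *
        (Real.exp (-(G.a * u 0 ^ 2 + 2 * G.b * u 0 * u 1 +
          ((G.b ^ 2 + 1 / 4) / G.a + G.d) * u 1 ^ 2) / 2) : ℝ) := by
    simp only [weylCLM_apply, inner_vec_weyl_vec, Complex.exp_add]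
    rw [integral_mul_const, integral_const_mul, integral_exp_gaussianReal, mul_assoc,
      Complex.ofReal_exp, Complex.ofReal_exp, ← Complex.exp_add]
    congr 2
    rw [mul_pow, Complex.I_sq]
    push_cast
    ring
  rw [e2] at h
  exact h

end PacketParam

/-! ### Identification of a Gaussian state with a mixture of packets -/

/-- The wave packet parameters of a Gaussian state. -/
def IsGaussianState.packet {ρ : L2 →L[ℂ] L2} {μ : Fin 2 → ℝ} {C : Matrix (Fin 2) (Fin 2) ℝ}
    (hρ : IsGaussianState ρ μ C) : PacketParam where
  a := ⟨C 0 0, hρ.uncertainty.1.le⟩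
  a_ne := fun h => hρ.uncertainty.1.ne' (congrArg NNReal.toReal h)
  b := C 0 1
  -- The momentum variance in excess of that of a pure packet; it is nonnegative exactly by the
  -- uncertainty relation.
  d := ⟨C 1 1 - (C 0 1 ^ 2 + 1 / 4) / C 0 0, by
    have h := hρ.uncertainty
    rw [sub_nonneg, div_le_iff₀ h.1]
    linarith [h.2]⟩
  mean := μ

theorem HasTrace.smul {T : L2 → L2} {t : ℂ} (h : HasTrace T t) (c : ℂ) :
    HasTrace (fun ψ => c • T ψ) (c * t) := by
  intro ι e
  simp only [inner_smul_right]
  exact (h ι e).mul_left c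

theorem IsGaussianState.eq_superposition {ρ : L2 →L[ℂ] L2} {μ : Fin 2 → ℝ}
    {C : Matrix (Fin 2) (Fin 2) ℝ} (hρ : IsGaussianState ρ μ C) :
    ρ = hρ.packet.superposition 1 := by
  refine eq_of_hasTrace_weyl hρ.isDensityOperator.isPositive
    hρ.packet.isPositive_superposition_one hρ.isDensityOperator.hasTrace
    (hρ.packet.hasTrace_superposition 1) _ (fun u => ?_) fun u =>
      hρ.packet.hasTrace_weyl_superposition u
  -- The phase undoes the centring by μ, leaving the trace of the plain Weyl operator.
  have h := (hasTrace_weyl_of_charFun (hρ.charFun u)).smul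
    (Complex.exp (Complex.I * ((u ⬝ᵥ μ : ℝ) : ℂ)))
  simp only [smul_smul, ← Complex.exp_add, neg_mul, add_neg_cancel, Complex.exp_zero,
    one_smul] at h
  rw [dotProduct_mulVec_fin_two hρ.isSymm] at h
  have e : -(C 0 0 * u 0 ^ 2 + 2 * C 0 1 * u 0 * u 1 + ((C 0 1 ^ 2 + 1 / 4) / C 0 0 +
      (C 1 1 - (C 0 1 ^ 2 + 1 / 4) / C 0 0)) * u 1 ^ 2) / 2 =
      -(C 0 0 * u 0 ^ 2 + 2 * C 0 1 * u 0 * u 1 + C 1 1 * u 1 ^ 2) / 2 := by ring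
  rw [← e] at h
  exact h

end QuantumDuffing

end

noncomputable section

namespace QuantumDuffing

open scoped NNReal
open MvPolynomial (C X)

/-! ### The mean square on polynomials -/

theorem gaussMoment_two (v : ℝ≥0) : gaussMoment v 2 = v := by
  rw [gaussMoment_add_two, gaussMoment_zero]; simp

theorem gaussMoment_three (v : ℝ≥0) : gaussMoment v 3 = 0 := by
  rw [gaussMoment_add_two, gaussMoment_one]; simp

theorem gaussMoment_four (v : ℝ≥0) : gaussMoment v 4 = 3 * (v : ℝ) ^ 2 := by
  rw [gaussMoment_add_two, gaussMoment_two]; push_cast; ring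

theorem gaussMoment_five (v : ℝ≥0) : gaussMoment v 5 = 0 := by
  rw [gaussMoment_add_two, gaussMoment_three]; simp

theorem gaussMoment_six (v : ℝ≥0) : gaussMoment v 6 = 15 * (v : ℝ) ^ 3 := by
  rw [gaussMoment_add_two, gaussMoment_four]; push_cast; ring

/-- The mean square of the modulus of a polynomial. -/
def gaussNorm (a d : ℝ≥0) (P : Symb) : ℝ := ∫ p, ‖evalSymb P p.1 p.2‖ ^ 2 ∂gaussLaw a d

theorem gaussNorm_nonneg (a d : ℝ≥0) (P : Symb) : 0 ≤ gaussNorm a d P :=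
  integral_nonneg fun p => by positivity

theorem gaussE_conj_mul_self (a d : ℝ≥0) (P : Symb) :
    gaussE a d (conjSymb P * P) = gaussNorm a d P := by
  rw [gaussE_apply, gaussNorm, ← integral_complex_ofReal]
  simp only [evalSymb_mul, evalSymb_conj, Complex.conj_mul', Complex.ofReal_pow]

theorem gaussNorm_sub_of_orthogonal {a d : ℝ≥0} {P Q : Symb}
    (h : gaussE a d (conjSymb Q * P) = 0) :
    gaussNorm a d (P - Q) = gaussNorm a d P + gaussNorm a d Q := by
  have h' : gaussE a d (conjSymb P * Q) = 0 := by
    have h1 := gaussE_conj a d (conjSymb Q * P)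
    have h2 : conjSymb (conjSymb Q) = Q := by
      simp only [conjSymb, MvPolynomial.map_map]
      have : (starRingEnd ℂ).comp (starRingEnd ℂ) = RingHom.id ℂ := by ext; simp
      rw [this, MvPolynomial.map_id]
    rw [h, map_mul, h2, map_zero, mul_comm] at h1
    exact h1
  have : ((gaussNorm a d (P - Q) : ℝ) : ℂ) = ((gaussNorm a d P + gaussNorm a d Q : ℝ) : ℂ) := by
    rw [← gaussE_conj_mul_self, map_sub, Complex.ofReal_add, ← gaussE_conj_mul_self,
      ← gaussE_conj_mul_self]
    rw [show (conjSymb P - conjSymb Q) * (P - Q) = conjSymb P * P - conjSymb P * Q -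
      conjSymb Q * P + conjSymb Q * Q by ring]
    simp only [map_add, map_sub, h, h']
    ring
  exact_mod_cast this

/-- A polynomial of degree two in two variables. -/
def quadPoly (c₀₀ c₁₀ c₀₁ c₂₀ c₁₁ c₀₂ : ℂ) : Symb :=
  C c₀₀ + C c₁₀ * X 0 + C c₀₁ * X 1 + C c₂₀ * X 0 ^ 2 + C c₁₁ * X 0 * X 1 + C c₀₂ * X 1 ^ 2

theorem conjSymb_quadPoly (c₀₀ c₁₀ c₀₁ c₂₀ c₁₁ c₀₂ : ℂ) :
    conjSymb (quadPoly c₀₀ c₁₀ c₀₁ c₂₀ c₁₁ c₀₂) =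
      quadPoly (starRingEnd ℂ c₀₀) (starRingEnd ℂ c₁₀) (starRingEnd ℂ c₀₁) (starRingEnd ℂ c₂₀)
        (starRingEnd ℂ c₁₁) (starRingEnd ℂ c₀₂) := by
  simp [quadPoly, conjSymb]

theorem gaussE_quadPoly (a d : ℝ≥0) (c₀₀ c₁₀ c₀₁ c₂₀ c₁₁ c₀₂ : ℂ) :
    gaussE a d (quadPoly c₀₀ c₁₀ c₀₁ c₂₀ c₁₁ c₀₂) = c₀₀ + c₂₀ * (a : ℝ) + c₀₂ * (d : ℝ) := by
  have : quadPoly c₀₀ c₁₀ c₀₁ c₂₀ c₁₁ c₀₂ = C c₀₀ * (X 0 ^ 0 * X 1 ^ 0) +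
      C c₁₀ * (X 0 ^ 1 * X 1 ^ 0) + C c₀₁ * (X 0 ^ 0 * X 1 ^ 1) + C c₂₀ * (X 0 ^ 2 * X 1 ^ 0) +
      C c₁₁ * (X 0 ^ 1 * X 1 ^ 1) + C c₀₂ * (X 0 ^ 0 * X 1 ^ 2) := by
    rw [quadPoly]; ring
  rw [this]
  simp only [map_add, gaussE_C_mul, gaussE_monomial, gaussMoment_zero, gaussMoment_one,
    gaussMoment_two]
  push_cast
  ring

theorem gaussE_quadPoly_mul_quadPoly (a d : ℝ≥0)
    (c₀₀ c₁₀ c₀₁ c₂₀ c₁₁ c₀₂ e₀₀ e₁₀ e₀₁ e₂₀ e₁₁ e₀₂ : ℂ) :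
    gaussE a d (quadPoly c₀₀ c₁₀ c₀₁ c₂₀ c₁₁ c₀₂ * quadPoly e₀₀ e₁₀ e₀₁ e₂₀ e₁₁ e₀₂) =
      (c₀₀ + c₂₀ * (a : ℝ) + c₀₂ * (d : ℝ)) * (e₀₀ + e₂₀ * (a : ℝ) + e₀₂ * (d : ℝ)) +
        c₁₀ * e₁₀ * (a : ℝ) + c₀₁ * e₀₁ * (d : ℝ) + 2 * (c₂₀ * e₂₀) * (a : ℝ) ^ 2 +
        c₁₁ * e₁₁ * ((a : ℝ) * (d : ℝ)) + 2 * (c₀₂ * e₀₂) * (d : ℝ) ^ 2 := by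
  have : quadPoly c₀₀ c₁₀ c₀₁ c₂₀ c₁₁ c₀₂ * quadPoly e₀₀ e₁₀ e₀₁ e₂₀ e₁₁ e₀₂ =
      C (c₀₀ * e₀₀) * (X 0 ^ 0 * X 1 ^ 0) +
      C (c₀₀ * e₁₀ + c₁₀ * e₀₀) * (X 0 ^ 1 * X 1 ^ 0) +
      C (c₀₀ * e₀₁ + c₀₁ * e₀₀) * (X 0 ^ 0 * X 1 ^ 1) +
      C (c₀₀ * e₂₀ + c₂₀ * e₀₀ + c₁₀ * e₁₀) * (X 0 ^ 2 * X 1 ^ 0) +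
      C (c₀₀ * e₁₁ + c₁₁ * e₀₀ + c₁₀ * e₀₁ + c₀₁ * e₁₀) * (X 0 ^ 1 * X 1 ^ 1) +
      C (c₀₀ * e₀₂ + c₀₂ * e₀₀ + c₀₁ * e₀₁) * (X 0 ^ 0 * X 1 ^ 2) +
      C (c₁₀ * e₂₀ + c₂₀ * e₁₀) * (X 0 ^ 3 * X 1 ^ 0) +
      C (c₁₀ * e₁₁ + c₁₁ * e₁₀ + c₀₁ * e₂₀ + c₂₀ * e₀₁) * (X 0 ^ 2 * X 1 ^ 1) +
      C (c₁₀ * e₀₂ + c₀₂ * e₁₀ + c₀₁ * e₁₁ + c₁₁ * e₀₁) * (X 0 ^ 1 * X 1 ^ 2) +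
      C (c₀₁ * e₀₂ + c₀₂ * e₀₁) * (X 0 ^ 0 * X 1 ^ 3) +
      C (c₂₀ * e₂₀) * (X 0 ^ 4 * X 1 ^ 0) +
      C (c₂₀ * e₁₁ + c₁₁ * e₂₀) * (X 0 ^ 3 * X 1 ^ 1) +
      C (c₂₀ * e₀₂ + c₀₂ * e₂₀ + c₁₁ * e₁₁) * (X 0 ^ 2 * X 1 ^ 2) +
      C (c₁₁ * e₀₂ + c₀₂ * e₁₁) * (X 0 ^ 1 * X 1 ^ 3) +
      C (c₀₂ * e₀₂) * (X 0 ^ 0 * X 1 ^ 4) := by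
    simp only [quadPoly, map_add, map_mul]
    ring
  rw [this]
  simp only [map_add (gaussE a d), gaussE_C_mul, gaussE_monomial, gaussMoment_zero, gaussMoment_one,
    gaussMoment_two, gaussMoment_three, gaussMoment_four]
  push_cast
  ring

/-- This is Parseval in the orthogonal basis 1, y, s, y² − a, ys, s² − d, whose squared norms are 1,
a, d, 2a², ad, 2d². -/
theorem gaussNorm_quadPoly (a d : ℝ≥0) (c₀₀ c₁₀ c₀₁ c₂₀ c₁₁ c₀₂ : ℂ) :
    gaussNorm a d (quadPoly c₀₀ c₁₀ c₀₁ c₂₀ c₁₁ c₀₂) =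
      ‖c₀₀ + c₂₀ * (a : ℝ) + c₀₂ * (d : ℝ)‖ ^ 2 + ‖c₁₀‖ ^ 2 * a + ‖c₀₁‖ ^ 2 * d +
        2 * ‖c₂₀‖ ^ 2 * (a : ℝ) ^ 2 + ‖c₁₁‖ ^ 2 * (a * d) + 2 * ‖c₀₂‖ ^ 2 * (d : ℝ) ^ 2 := by
  have h := gaussE_conj_mul_self a d (quadPoly c₀₀ c₁₀ c₀₁ c₂₀ c₁₁ c₀₂)
  rw [conjSymb_quadPoly, gaussE_quadPoly_mul_quadPoly] at h
  have e : starRingEnd ℂ c₀₀ + starRingEnd ℂ c₂₀ * (a : ℝ) + starRingEnd ℂ c₀₂ * (d : ℝ) =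
      starRingEnd ℂ (c₀₀ + c₂₀ * (a : ℝ) + c₀₂ * (d : ℝ)) := by simp
  rw [e] at h
  simp only [Complex.conj_mul'] at h
  exact_mod_cast h.symm

/-- The combination `H₄ + 4 κ H₃` of Hermite polynomials of the centered position. -/
def hermitePoly (a : ℝ≥0) (κ : ℝ) : Symb :=
  (X 0 ^ 4 - C (6 * (a : ℝ) : ℂ) * X 0 ^ 2 + C (3 * (a : ℝ) ^ 2 : ℂ)) +
    C (4 * κ : ℂ) * (X 0 ^ 3 - C (3 * (a : ℝ) : ℂ) * X 0)

/-- H₃ and H₄ are orthogonal to lower powers of y, while the power of s is arbitrary because the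
variables are independent. -/
theorem gaussE_monomial_mul_hermitePoly (a d : ℝ≥0) (κ : ℝ) {k : ℕ} (hk : k ≤ 2) (j : ℕ) :
    gaussE a d (X 0 ^ k * X 1 ^ j * hermitePoly a κ) = 0 := by
  have : (X 0 ^ k * X 1 ^ j * hermitePoly a κ : Symb) =
      X 0 ^ (k + 4) * X 1 ^ j - C (6 * (a : ℝ) : ℂ) * (X 0 ^ (k + 2) * X 1 ^ j) +
        C (3 * (a : ℝ) ^ 2 : ℂ) * (X 0 ^ k * X 1 ^ j) +
        C (4 * κ : ℂ) * (X 0 ^ (k + 3) * X 1 ^ j) -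
        C (4 * κ : ℂ) * (C (3 * (a : ℝ) : ℂ) * (X 0 ^ (k + 1) * X 1 ^ j)) := by
    rw [hermitePoly]; ring
  rw [this]
  simp only [map_add, map_sub, gaussE_C_mul, gaussE_monomial]
  interval_cases k <;>
  · simp only [zero_add, Nat.reduceAdd, gaussMoment_zero, gaussMoment_one, gaussMoment_two,
      gaussMoment_three, gaussMoment_four, gaussMoment_five, gaussMoment_six]
    push_cast
    ring

theorem gaussE_quadPoly_mul_hermitePoly (a d : ℝ≥0) (κ : ℝ) (c₀₀ c₁₀ c₀₁ c₂₀ c₁₁ c₀₂ : ℂ) :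
    gaussE a d (quadPoly c₀₀ c₁₀ c₀₁ c₂₀ c₁₁ c₀₂ * hermitePoly a κ) = 0 := by
  have : quadPoly c₀₀ c₁₀ c₀₁ c₂₀ c₁₁ c₀₂ * hermitePoly a κ =
      C c₀₀ * (X 0 ^ 0 * X 1 ^ 0 * hermitePoly a κ) +
      C c₁₀ * (X 0 ^ 1 * X 1 ^ 0 * hermitePoly a κ) +
      C c₀₁ * (X 0 ^ 0 * X 1 ^ 1 * hermitePoly a κ) +
      C c₂₀ * (X 0 ^ 2 * X 1 ^ 0 * hermitePoly a κ) +
      C c₁₁ * (X 0 ^ 1 * X 1 ^ 1 * hermitePoly a κ) +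
      C c₀₂ * (X 0 ^ 0 * X 1 ^ 2 * hermitePoly a κ) := by
    rw [quadPoly]; ring
  rw [this]
  simp only [map_add, gaussE_C_mul]
  rw [gaussE_monomial_mul_hermitePoly a d κ (by norm_num), gaussE_monomial_mul_hermitePoly a d κ
    (by norm_num), gaussE_monomial_mul_hermitePoly a d κ (by norm_num),
    gaussE_monomial_mul_hermitePoly a d κ le_rfl, gaussE_monomial_mul_hermitePoly a d κ
    (by norm_num), gaussE_monomial_mul_hermitePoly a d κ (by norm_num)]
  ring

namespace PacketParam

variable (G : PacketParam)

/-! ### Symmetric operators on the symbols -/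

/-- The operator `L` is symmetric for the inner product of the symbols. -/
def IsSymm (L : Symb →ₗ[ℂ] Symb) : Prop :=
  ∀ P Q, gaussE G.a G.d (conjSymb P * L Q) = gaussE G.a G.d (conjSymb (L P) * Q)

variable {G}

theorem IsSymm.id : G.IsSymm LinearMap.id := fun _ _ => rfl

theorem IsSymm.add {L M : Symb →ₗ[ℂ] Symb} (hL : G.IsSymm L) (hM : G.IsSymm M) :
    G.IsSymm (L + M) := fun P Q => by
  simp only [LinearMap.add_apply, mul_add, add_mul, map_add, hL P Q, hM P Q]

theorem conjSymb_smul (c : ℂ) (P : Symb) : conjSymb (c • P) = starRingEnd ℂ c • conjSymb P := by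
  simp [MvPolynomial.smul_eq_C_mul, conjSymb]

theorem IsSymm.smul {L : Symb →ₗ[ℂ] Symb} (hL : G.IsSymm L) {c : ℂ}
    (hc : starRingEnd ℂ c = c) : G.IsSymm (c • L) := fun P Q => by
  simp only [LinearMap.smul_apply, conjSymb_smul, hc, mul_smul_comm, smul_mul_assoc, map_smul,
    hL P Q]

theorem IsSymm.sub {L M : Symb →ₗ[ℂ] Symb} (hL : G.IsSymm L) (hM : G.IsSymm M) :
    G.IsSymm (L - M) := fun P Q => by
  simp only [LinearMap.sub_apply, mul_sub, sub_mul, map_sub, hL P Q, hM P Q]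

theorem IsSymm.pow {L : Symb →ₗ[ℂ] Symb} (hL : G.IsSymm L) (n : ℕ) : G.IsSymm (L ^ n) := by
  induction n with
  | zero => exact IsSymm.id
  | succ n ih =>
    intro P Q
    rw [pow_succ']
    change gaussE G.a G.d (conjSymb P * L ((L ^ n) Q)) = _
    rw [hL, ih, ← Module.End.mul_apply, ← pow_succ, pow_succ']

/-- A product of noncommuting symmetric maps need not be symmetric, but the anticommutator is. This
is where symmetry of R enters `isSymm_quadSymb`. -/
theorem IsSymm.anticomm {L M : Symb →ₗ[ℂ] Symb} (hL : G.IsSymm L) (hM : G.IsSymm M) :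
    G.IsSymm (L ∘ₗ M + M ∘ₗ L) := fun P Q => by
  simp only [LinearMap.add_apply, LinearMap.comp_apply, mul_add, add_mul, map_add]
  rw [hL P (M Q), hM (L P) Q, hM P (L Q), hL (M P) Q, add_comm]

variable (G)

/-- The logarithmic derivative of the centered wave packets, divided by the imaginary unit. -/
def shift : Symb := C G.z * X 0 + X 1

/-- The action of the centered observables on the symbols. -/
def obsSymb : Fin 2 → Symb →ₗ[ℂ] Symb :=
  ![LinearMap.mulLeft ℂ (X 0),
    (-Complex.I) • (MvPolynomial.pderiv (R := ℂ) (0 : Fin 2)).toLinearMap +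
      LinearMap.mulLeft ℂ G.shift]

theorem obsSymb_zero_apply (P : Symb) : G.obsSymb 0 P = X 0 * P := rfl

theorem obsSymb_one_apply (P : Symb) :
    G.obsSymb 1 P = C (-Complex.I) * MvPolynomial.pderiv 0 P + G.shift * P := by
  rw [← MvPolynomial.smul_eq_C_mul]; rfl

/-- For the momentum, integration by parts against the Gaussian weight produces a factor y/a. It is
balanced by the nonreal part of the shift, since a(z − conj z) = i. -/
theorem isSymm_obsSymb (j : Fin 2) : G.IsSymm (G.obsSymb j) := by
  intro P Q
  fin_cases j
  · simp only [Fin.zero_eta, obsSymb_zero_apply, map_mul]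
    rw [show conjSymb (X 0) = X 0 by simp [conjSymb]]
    congr 1
    ring
  · simp only [Fin.mk_one, obsSymb_one_apply]
    have h := gaussE_X_mul G.a G.d (conjSymb P * Q)
    rw [MvPolynomial.pderiv_mul, map_add, pderiv_conj] at h
    have e1 : conjSymb P * (C (-Complex.I) * MvPolynomial.pderiv 0 Q + G.shift * Q) =
        C (-Complex.I) * (conjSymb P * MvPolynomial.pderiv 0 Q) +
          C G.z * (X 0 * (conjSymb P * Q)) + X 1 * (conjSymb P * Q) := by
      rw [shift]; ring
    have e2 : conjSymb (C (-Complex.I) * MvPolynomial.pderiv 0 P + G.shift * P) * Q =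
        C Complex.I * (conjSymb (MvPolynomial.pderiv 0 P) * Q) +
          C (starRingEnd ℂ G.z) * (X 0 * (conjSymb P * Q)) + X 1 * (conjSymb P * Q) := by
      have : ∀ c : ℂ, conjSymb (C c) = C (starRingEnd ℂ c) := fun c => by simp [conjSymb]
      have hX : ∀ i, conjSymb (X i) = X i := fun i => by simp [conjSymb]
      rw [shift]
      simp only [map_add, map_mul, this, hX, map_neg, Complex.conj_I, neg_neg]
      ring
    rw [e1, e2]
    simp only [map_add, gaussE_C_mul, h]
    have hz := G.a_mul_z
    have hz' := congrArg (starRingEnd ℂ) hz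
    simp only [map_mul, map_add, map_div₀, Complex.conj_ofReal, Complex.conj_I,
      Complex.conj_ofNat] at hz'
    set u := gaussE G.a G.d (conjSymb (MvPolynomial.pderiv 0 P) * Q)
    set v := gaussE G.a G.d (conjSymb P * MvPolynomial.pderiv 0 Q)
    linear_combination (u + v) * hz - (u + v) * hz'

/-- The action of the quadratic operators on the symbols. -/
def quadSymb (α : ℝ) (β : Fin 2 → ℝ) (R : Matrix (Fin 2) (Fin 2) ℝ) : Symb →ₗ[ℂ] Symb :=
  (α : ℂ) • LinearMap.id + ∑ j, (β j : ℂ) • G.obsSymb j +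
    (1 / 2 : ℂ) • ∑ j, ∑ k, (R j k : ℂ) • (G.obsSymb j ∘ₗ G.obsSymb k)

theorem isSymm_quadSymb (α : ℝ) (β : Fin 2 → ℝ) {R : Matrix (Fin 2) (Fin 2) ℝ}
    (hR : R.IsSymm) : G.IsSymm (G.quadSymb α β R) := by
  have h0 := G.isSymm_obsSymb 0
  have h1 := G.isSymm_obsSymb 1
  have hr : ∀ r : ℝ, starRingEnd ℂ (r : ℂ) = r := Complex.conj_ofReal
  have e : G.quadSymb α β R = (α : ℂ) • LinearMap.id + ((β 0 : ℂ) • G.obsSymb 0 +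
      (β 1 : ℂ) • G.obsSymb 1) + (1 / 2 : ℂ) • ((R 0 0 : ℂ) • G.obsSymb 0 ^ 2 +
        (R 0 1 : ℂ) • (G.obsSymb 0 ∘ₗ G.obsSymb 1 + G.obsSymb 1 ∘ₗ G.obsSymb 0) +
        (R 1 1 : ℂ) • G.obsSymb 1 ^ 2) := by
    have hs : R 1 0 = R 0 1 := hR.apply 0 1
    simp only [quadSymb, Fin.sum_univ_two, hs, sq, Module.End.mul_eq_comp, smul_add]
    abel
  rw [e]
  exact ((IsSymm.id.smul (hr _)).add ((h0.smul (hr _)).add (h1.smul (hr _)))).add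
    (((((h0.pow 2).smul (hr _)).add ((h0.anticomm h1).smul (hr _))).add
      ((h1.pow 2).smul (hr _))).smul (by simp [Complex.conj_ofNat]))

theorem pderiv_shift : MvPolynomial.pderiv 0 G.shift = C G.z := by
  simp [shift, MvPolynomial.pderiv_X_of_ne (show (1 : Fin 2) ≠ 0 by decide)]

/-- The constants −i and −iz arise when the derivative in the momentum map hits y and the shift. -/
theorem quadSymb_one (α : ℝ) (β : Fin 2 → ℝ) {R : Matrix (Fin 2) (Fin 2) ℝ} (hR : R.IsSymm) :
    G.quadSymb α β R 1 = C (α : ℂ) + C (β 0 : ℂ) * X 0 + C (β 1 : ℂ) * G.shift +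
      C (1 / 2) * (C (R 0 0 : ℂ) * X 0 ^ 2 + C (R 0 1 : ℂ) * (2 * (X 0 * G.shift) - C Complex.I) +
        C (R 1 1 : ℂ) * (G.shift ^ 2 - C (Complex.I * G.z))) := by
  have hs : R 1 0 = R 0 1 := hR.apply 0 1
  simp only [quadSymb, Fin.sum_univ_two, LinearMap.add_apply, LinearMap.smul_apply,
    LinearMap.comp_apply, LinearMap.id_apply, obsSymb_zero_apply, obsSymb_one_apply, hs,
    MvPolynomial.smul_eq_C_mul, mul_one, MvPolynomial.pderiv_X_self, pderiv_shift,
    MvPolynomial.pderiv_one, mul_zero, zero_add, map_neg, map_mul]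
  ring

theorem quadSymb_one_eq_quadPoly (α : ℝ) (β : Fin 2 → ℝ) {R : Matrix (Fin 2) (Fin 2) ℝ}
    (hR : R.IsSymm) : G.quadSymb α β R 1 = quadPoly
      (α - Complex.I * R 0 1 / 2 - Complex.I * G.z * R 1 1 / 2) (β 0 + β 1 * G.z) (β 1)
      (1 / 2 * (R 0 0 + 2 * R 0 1 * G.z + R 1 1 * G.z ^ 2)) (R 0 1 + R 1 1 * G.z)
      (1 / 2 * R 1 1) := by
  rw [G.quadSymb_one α β hR, quadPoly, shift]
  have h2 : (2 : Symb) * C (1 / 2) = 1 := by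
    rw [show (2 : Symb) = C 2 from rfl, ← map_mul]; norm_num
  simp only [map_add, map_sub, map_mul, map_pow, div_eq_mul_inv, one_mul] at h2 ⊢
  rw [show (C (2 : ℂ) : Symb) = 2 from rfl]
  linear_combination (C (R 0 1 : ℂ) * X 0 * X 1 + C (R 1 1 : ℂ) * X 0 * X 1 * C G.z) * h2

end PacketParam

end QuantumDuffing

end

noncomputable section

namespace QuantumDuffing

open scoped NNReal
open MvPolynomial (C X)

namespace PacketParam

variable (G : PacketParam)

/-! ### Mean square deviations as Gaussian norms, and the optimality criterion -/

theorem posSymb_eq : G.posSymb = G.obsSymb 0 + (G.mean 0 : ℂ) • LinearMap.id := by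
  refine LinearMap.ext fun P => ?_
  simp only [posSymb, LinearMap.mulLeft_apply, LinearMap.add_apply, LinearMap.smul_apply,
    LinearMap.id_apply, obsSymb_zero_apply, MvPolynomial.smul_eq_C_mul]
  ring

theorem momSymb_eq : G.momSymb = G.obsSymb 1 + (G.mean 1 : ℂ) • LinearMap.id := by
  refine LinearMap.ext fun P => ?_
  have hI : (C (-Complex.I) * C Complex.I : Symb) = 1 := by
    rw [← map_mul]; simp
  simp only [momSymb, derivSymb, logDeriv, shift, LinearMap.mulLeft_apply, LinearMap.add_apply,
    LinearMap.smul_apply, LinearMap.id_apply, obsSymb_one_apply, MvPolynomial.smul_eq_C_mul,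
    Derivation.coeFn_coe]
  linear_combination ((C G.z * X 0 + C (G.mean 1 : ℂ) + X 1) * P) * hI

theorem intertwines_centeredObs (j : Fin 2) :
    Intertwines G.superposition (centeredObs G.mean j) (G.obsSymb j) := by
  fin_cases j
  · have h := G.intertwines_position.sub (Intertwines.id.smul (G.mean 0 : ℂ))
    rwa [posSymb_eq, add_sub_cancel_right] at h
  · have h := G.intertwines_momentum.sub (Intertwines.id.smul (G.mean 1 : ℂ))
    rwa [momSymb_eq, add_sub_cancel_right] at h

theorem intertwines_quadOp (α : ℝ) (β : Fin 2 → ℝ) (R : Matrix (Fin 2) (Fin 2) ℝ) :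
    Intertwines G.superposition (quadOp G.mean α β R) (G.quadSymb α β R) :=
  ((Intertwines.id.smul _).add
    (Intertwines.sum _ fun j => (G.intertwines_centeredObs j).smul _)).add
    ((Intertwines.sum _ fun j => Intertwines.sum _ fun k =>
      ((G.intertwines_centeredObs j).mul (G.intertwines_centeredObs k)).smul _).smul _)

variable {G}

theorem hasExpectation_of_intertwines {A : Op} {L : Symb →ₗ[ℂ] Symb}
    (hA : Intertwines G.superposition A L) {c : ℂ} (hc : gaussE G.a G.d (L 1) = c) :
    HasExpectation (G.superposition 1) A c :=
  hA.hasExpectation (hc ▸ G.hasTrace_superposition (L 1))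

/-- The mean square deviation of an observable from a quadratic one is a Gaussian mean square. -/
theorem hasMeanSquareDev {A : Op} {L : Symb →ₗ[ℂ] Symb} (hA : Intertwines G.superposition A L)
    (hL : G.IsSymm L) (m α : ℝ) (β : Fin 2 → ℝ) {R : Matrix (Fin 2) (Fin 2) ℝ} (hR : R.IsSymm) :
    HasMeanSquareDev (G.superposition 1) G.mean A m α β R
      (gaussNorm G.a G.d
        ((L - (m : ℂ) • LinearMap.id - G.quadSymb α β R : Symb →ₗ[ℂ] Symb) 1)) := by
  have hB := (hA.sub (Intertwines.id.smul (m : ℂ))).sub (G.intertwines_quadOp α β R)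
  have hS := (hL.sub (IsSymm.id.smul (Complex.conj_ofReal m))).sub (G.isSymm_quadSymb α β hR)
  refine hasExpectation_of_intertwines (hB.pow 2) ?_
  -- For the symmetric map K of the deviation, the expectation of K²1 is ⟨1, K(K1)⟩ = ⟨K1, K1⟩.
  rw [← gaussE_conj_mul_self, ← hS, sq, Module.End.mul_apply]
  have h := hS 1 ((L - (m : ℂ) • LinearMap.id - G.quadSymb α β R : Symb →ₗ[ℂ] Symb) 1)
  rw [map_one conjSymb, one_mul] at h
  rw [h, ← hS]

theorem quadSymb_add_sub (α α' : ℝ) (β β' : Fin 2 → ℝ) {R R' : Matrix (Fin 2) (Fin 2) ℝ}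
    (hR : R.IsSymm) (hR' : R'.IsSymm) : G.quadSymb α' β' R' 1 =
      G.quadSymb α β R 1 + G.quadSymb (α' - α) (β' - β) (R' - R) 1 := by
  rw [G.quadSymb_one α β hR, G.quadSymb_one α' β' hR', G.quadSymb_one _ _ (hR'.sub hR)]
  simp only [Pi.sub_apply, Matrix.sub_apply, Complex.ofReal_sub, map_sub]
  ring

/-- With a and d positive every square in the Parseval sum must vanish. The parameters are then read
off from the highest order in s downwards, since each coefficient involves only one parameter not
yet known to be zero. -/
theorem eq_zero_of_gaussNorm_quadSymb {α : ℝ} {β : Fin 2 → ℝ} {R : Matrix (Fin 2) (Fin 2) ℝ}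
    (hR : R.IsSymm) (hd : G.d ≠ 0) (h : gaussNorm G.a G.d (G.quadSymb α β R 1) ≤ 0) :
    α = 0 ∧ β = 0 ∧ R = 0 := by
  have hd' : (0 : ℝ) < G.d := by positivity
  have ha := G.a_pos
  rw [G.quadSymb_one_eq_quadPoly α β hR, gaussNorm_quadPoly] at h
  set c₀₀ : ℂ := α - Complex.I * R 0 1 / 2 - Complex.I * G.z * R 1 1 / 2
  set c₁₀ : ℂ := β 0 + β 1 * G.z
  set c₂₀ : ℂ := 1 / 2 * (R 0 0 + 2 * R 0 1 * G.z + R 1 1 * G.z ^ 2)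
  set c₁₁ : ℂ := R 0 1 + R 1 1 * G.z
  set c₀₂ : ℂ := 1 / 2 * R 1 1
  have p0 : 0 ≤ ‖c₀₀ + c₂₀ * (G.a : ℝ) + c₀₂ * (G.d : ℝ)‖ ^ 2 := by positivity
  have p1 : 0 ≤ ‖c₁₀‖ ^ 2 * G.a := by positivity
  have p2 : 0 ≤ ‖(β 1 : ℂ)‖ ^ 2 * G.d := by positivity
  have p3 : 0 ≤ 2 * ‖c₂₀‖ ^ 2 * (G.a : ℝ) ^ 2 := by positivity
  have p4 : 0 ≤ ‖c₁₁‖ ^ 2 * ((G.a : ℝ) * G.d) := by positivity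
  have p5 : 0 ≤ 2 * ‖c₀₂‖ ^ 2 * (G.d : ℝ) ^ 2 := by positivity
  have z0 : ‖c₀₀ + c₂₀ * (G.a : ℝ) + c₀₂ * (G.d : ℝ)‖ ^ 2 = 0 := by linarith
  have z1 : ‖c₁₀‖ ^ 2 * G.a = 0 := by linarith
  have z2 : ‖(β 1 : ℂ)‖ ^ 2 * G.d = 0 := by linarith
  have z3 : 2 * ‖c₂₀‖ ^ 2 * (G.a : ℝ) ^ 2 = 0 := by linarith
  have z4 : ‖c₁₁‖ ^ 2 * ((G.a : ℝ) * G.d) = 0 := by linarith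
  have z5 : 2 * ‖c₀₂‖ ^ 2 * (G.d : ℝ) ^ 2 = 0 := by linarith
  have r11 : R 1 1 = 0 := by simpa [c₀₂, hd'.ne', ha.ne'] using z5
  have r01 : R 0 1 = 0 := by simpa [c₁₁, r11, hd'.ne', ha.ne', G.a_ne, hd] using z4
  have r00 : R 0 0 = 0 := by simpa [c₂₀, r11, r01, ha.ne', G.a_ne] using z3
  have b1 : β 1 = 0 := by simpa [hd'.ne', hd] using z2
  have b0 : β 0 = 0 := by simpa [c₁₀, b1, ha.ne', G.a_ne] using z1
  have a0 : α = 0 := by simpa [c₀₀, c₂₀, c₀₂, r00, r01, r11] using z0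
  have r10 : R 1 0 = 0 := (hR.apply 0 1).trans r01
  refine ⟨a0, ?_, ?_⟩
  · ext j; fin_cases j <;> assumption
  · ext j k; fin_cases j <;> fin_cases k <;> assumption

/-- If an observable differs from a quadratic one by a multiple of `H₄ + 4 κ H₃`, then that
quadratic observable is its optimal quadratic approximation. -/
theorem isOptimalQuadApprox {A : Op} {L : Symb →ₗ[ℂ] Symb}
    (hA : Intertwines G.superposition A L) (hL : G.IsSymm L) {m f α : ℝ} {β : Fin 2 → ℝ}
    {R : Matrix (Fin 2) (Fin 2) ℝ} (hR : R.IsSymm) (hm : gaussE G.a G.d (L 1) = m)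
    (hres : L 1 - C (m : ℂ) - G.quadSymb α β R 1 = C (f : ℂ) * hermitePoly G.a (G.mean 0)) :
    IsOptimalQuadApprox (G.superposition 1) G.mean A α β R ∧
      (G.d ≠ 0 → ∀ (α' : ℝ) (β' : Fin 2 → ℝ) (R' : Matrix (Fin 2) (Fin 2) ℝ),
        IsOptimalQuadApprox (G.superposition 1) G.mean A α' β' R' →
          α' = α ∧ β' = β ∧ R' = R) := by
  set N := gaussNorm G.a G.d (C (f : ℂ) * hermitePoly G.a (G.mean 0)) with hN
  have hexp : HasExpectation (G.superposition 1) A m := hasExpectation_of_intertwines hA hm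
  -- Pythagoras: the residual is orthogonal to every quadratic symbol, so a competing triple adds
  -- exactly the norm of the difference.
  have hdev : ∀ (α' : ℝ) (β' : Fin 2 → ℝ) {R' : Matrix (Fin 2) (Fin 2) ℝ}, R'.IsSymm →
      HasMeanSquareDev (G.superposition 1) G.mean A m α' β' R'
        (N + gaussNorm G.a G.d (G.quadSymb (α' - α) (β' - β) (R' - R) 1)) := by
    intro α' β' R' hR'
    have h := hasMeanSquareDev hA hL m α' β' hR'
    have e : (L - (m : ℂ) • LinearMap.id - G.quadSymb α' β' R' : Symb →ₗ[ℂ] Symb) 1 =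
        C (f : ℂ) * hermitePoly G.a (G.mean 0) -
          G.quadSymb (α' - α) (β' - β) (R' - R) 1 := by
      rw [← hres, LinearMap.sub_apply, LinearMap.sub_apply, LinearMap.smul_apply,
        LinearMap.id_apply, MvPolynomial.smul_eq_C_mul, mul_one,
        G.quadSymb_add_sub α α' β β' hR hR']
      ring
    rwa [e, gaussNorm_sub_of_orthogonal] at h
    rw [G.quadSymb_one_eq_quadPoly _ _ (hR'.sub hR), conjSymb_quadPoly, mul_left_comm,
      gaussE_C_mul, gaussE_quadPoly_mul_hermitePoly, mul_zero]
  have hopt : HasMeanSquareDev (G.superposition 1) G.mean A m α β R N := by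
    have h := hdev α β hR
    have e : gaussNorm G.a G.d (G.quadSymb (α - α) (β - β) (R - R) 1) = 0 := by
      simp [quadSymb, gaussNorm]
    rwa [e, add_zero] at h
  refine ⟨⟨hR, m, hexp, N, hopt, fun α' β' R' hR' => ⟨_, hdev α' β' hR', ?_⟩⟩, ?_⟩
  · exact le_add_of_nonneg_right (gaussNorm_nonneg _ _ _)
  · rintro hd α' β' R' ⟨hR', m', hm', Q, hQ, hmin⟩
    -- The mean and the two deviations that come with the competing triple are forced by uniqueness
    -- of traces.
    obtain rfl : m' = m := by exact_mod_cast hm'.unique hexp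
    obtain ⟨Q', hQ', hle⟩ := hmin α β R hR
    have e1 : Q' = N := by exact_mod_cast HasExpectation.unique hQ' hopt
    have e2 : Q = N + gaussNorm G.a G.d (G.quadSymb (α' - α) (β' - β) (R' - R) 1) := by
      exact_mod_cast HasExpectation.unique hQ (hdev α' β' hR')
    obtain ⟨h1, h2, h3⟩ := eq_zero_of_gaussNorm_quadSymb (hR'.sub hR) hd (by linarith)
    exact ⟨sub_eq_zero.1 h1, sub_eq_zero.1 h2, sub_eq_zero.1 h3⟩

variable (G)

/-! ### The first moments and the covariances -/

/-- The variance of the momentum. -/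
def momVar : ℝ := (G.b ^ 2 + 1 / 4) / G.a + G.d

/-- The left side is the Gaussian expectation of the symbol of the squared centred momentum. Since
az = b + i/2, its first two terms give z(b − i/2) = (b² + 1/4)/a, so the imaginary parts cancel. -/
theorem z_sq_mul_a : G.z ^ 2 * (G.a : ℝ) - Complex.I * G.z + (G.d : ℝ) = G.momVar := by
  have ha : ((G.a : ℝ) : ℂ) ≠ 0 := by exact_mod_cast G.a_pos.ne'
  rw [momVar, z]
  push_cast
  field_simp
  ring_nf
  simp only [Complex.I_sq]
  ring

theorem posSymb_pow_one (n : ℕ) : (G.posSymb ^ n) 1 = (X 0 + C (G.mean 0 : ℂ)) ^ n := by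
  rw [posSymb, LinearMap.pow_mulLeft, LinearMap.mulLeft_apply, mul_one]

theorem obsSymb_zero_pow_one (n : ℕ) : (G.obsSymb 0 ^ n) 1 = X 0 ^ n := by
  change (LinearMap.mulLeft ℂ (X 0 : Symb) ^ n) 1 = _
  rw [LinearMap.pow_mulLeft, LinearMap.mulLeft_apply, mul_one]

theorem momSymb_sq_one : (G.momSymb ^ 2) 1 = G.shift ^ 2 - C (Complex.I * G.z) +
    C (2 * G.mean 1 : ℂ) * G.shift + C (G.mean 1 : ℂ) ^ 2 := by
  rw [sq, Module.End.mul_apply, momSymb_eq]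
  simp only [LinearMap.add_apply, LinearMap.smul_apply, LinearMap.id_apply, obsSymb_one_apply,
    MvPolynomial.smul_eq_C_mul, MvPolynomial.pderiv_one, mul_zero, zero_add, mul_one, map_add,
    pderiv_shift, MvPolynomial.pderiv_C, map_mul, map_neg]
  rw [show (C (2 : ℂ) : Symb) = 2 from rfl]
  ring

theorem gaussE_momSymb_sq : gaussE G.a G.d ((G.momSymb ^ 2) 1) = (G.momVar + G.mean 1 ^ 2 : ℝ) := by
  have : (G.momSymb ^ 2) 1 = quadPoly ((G.mean 1 : ℂ) ^ 2 - Complex.I * G.z)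
      (2 * G.mean 1 * G.z) (2 * G.mean 1) (G.z ^ 2) (2 * G.z) 1 := by
    rw [momSymb_sq_one, quadPoly, shift]
    simp only [map_sub, map_mul, map_pow, map_one]
    rw [show (C (2 : ℂ) : Symb) = 2 from rfl]
    ring
  rw [this, gaussE_quadPoly, Complex.ofReal_add, ← z_sq_mul_a]
  push_cast
  ring

theorem gaussE_posSymb_sq :
    gaussE G.a G.d ((G.posSymb ^ 2) 1) = (G.a + G.mean 0 ^ 2 : ℝ) := by
  have : (G.posSymb ^ 2) 1 = quadPoly ((G.mean 0 : ℂ) ^ 2) (2 * G.mean 0) 0 1 0 0 := by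
    rw [posSymb_pow_one, quadPoly]
    simp only [map_mul, map_pow, map_one, map_zero]
    rw [show (C (2 : ℂ) : Symb) = 2 from rfl]
    ring
  rw [this, gaussE_quadPoly]
  push_cast
  ring

theorem gaussE_posSymb_four : gaussE G.a G.d ((G.posSymb ^ 4) 1) =
    (G.mean 0 ^ 4 + 6 * G.mean 0 ^ 2 * G.a + 3 * G.a ^ 2 : ℝ) := by
  have : (G.posSymb ^ 4) 1 = X 0 ^ 4 * X 1 ^ 0 + C (4 * G.mean 0 : ℂ) * (X 0 ^ 3 * X 1 ^ 0) +
      C (6 * G.mean 0 ^ 2 : ℂ) * (X 0 ^ 2 * X 1 ^ 0) +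
      C (4 * G.mean 0 ^ 3 : ℂ) * (X 0 ^ 1 * X 1 ^ 0) +
      C ((G.mean 0 : ℂ) ^ 4) * (X 0 ^ 0 * X 1 ^ 0) := by
    rw [posSymb_pow_one]
    refine MvPolynomial.funext fun x => ?_
    simp
    ring
  rw [this]
  simp only [map_add (gaussE G.a G.d), gaussE_C_mul, gaussE_monomial, gaussMoment_zero,
    gaussMoment_one, gaussMoment_two, gaussMoment_three, gaussMoment_four]
  push_cast
  ring

theorem gaussE_nonquad : gaussE G.a G.d (C ((4 * G.mean 0 : ℝ) : ℂ) * X 0 ^ 3 + X 0 ^ 4) =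
    (3 * G.a ^ 2 : ℝ) := by
  have : (C ((4 * G.mean 0 : ℝ) : ℂ) * X 0 ^ 3 + X 0 ^ 4 : Symb) =
      C ((4 * G.mean 0 : ℝ) : ℂ) * (X 0 ^ 3 * X 1 ^ 0) + X 0 ^ 4 * X 1 ^ 0 := by ring
  rw [this]
  simp only [map_add (gaussE G.a G.d), gaussE_C_mul, gaussE_monomial, gaussMoment_zero,
    gaussMoment_three, gaussMoment_four]
  push_cast
  ring

theorem hasExpectation_obs (j : Fin 2) :
    HasExpectation (G.superposition 1) (obs j) (G.mean j) := by
  fin_cases j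
  · refine hasExpectation_of_intertwines G.intertwines_position ?_
    have : G.posSymb 1 = quadPoly (G.mean 0) 1 0 0 0 0 := by
      simp [posSymb, quadPoly]; ring
    rw [this, gaussE_quadPoly]
    simp
  · refine hasExpectation_of_intertwines G.intertwines_momentum ?_
    have : G.momSymb 1 = quadPoly (G.mean 1) G.z 1 0 0 0 := by
      simp [momSymb_eq, quadPoly, obsSymb_one_apply, shift, MvPolynomial.smul_eq_C_mul]; ring
    rw [this, gaussE_quadPoly]
    simp

theorem hasExpectation_mul (j k : Fin 2) :
    HasExpectation (G.superposition 1) (opMul (centeredObs G.mean j) (centeredObs G.mean k))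
      (quantumCov !![(G.a : ℝ), G.b; G.b, G.momVar] j k) := by
  refine hasExpectation_of_intertwines
    ((G.intertwines_centeredObs j).mul (G.intertwines_centeredObs k)) ?_
  have hz := G.a_mul_z
  have hz2 := G.z_sq_mul_a
  fin_cases j <;> fin_cases k
  · have : G.obsSymb 0 (G.obsSymb 0 1) = quadPoly 0 0 0 1 0 0 := by
      simp [obsSymb_zero_apply, quadPoly]; ring
    change gaussE G.a G.d (G.obsSymb 0 (G.obsSymb 0 1)) = _
    rw [this, gaussE_quadPoly]
    simp [quantumCov, J]
  · have : G.obsSymb 0 (G.obsSymb 1 1) = quadPoly 0 0 0 G.z 1 0 := by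
      simp [obsSymb_zero_apply, obsSymb_one_apply, shift, quadPoly]; ring
    change gaussE G.a G.d (G.obsSymb 0 (G.obsSymb 1 1)) = _
    rw [this, gaussE_quadPoly]
    simp [quantumCov, J]
    rw [mul_comm, hz]
  · have : G.obsSymb 1 (G.obsSymb 0 1) = quadPoly (-Complex.I) 0 0 G.z 1 0 := by
      simp [obsSymb_zero_apply, obsSymb_one_apply, shift, quadPoly]; ring
    change gaussE G.a G.d (G.obsSymb 1 (G.obsSymb 0 1)) = _
    rw [this, gaussE_quadPoly]
    simp [quantumCov, J]
    linear_combination hz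
  · have : G.obsSymb 1 (G.obsSymb 1 1) =
        quadPoly (-(Complex.I * G.z)) 0 0 (G.z ^ 2) (2 * G.z) 1 := by
      simp only [obsSymb_one_apply, MvPolynomial.pderiv_one, mul_zero, zero_add, mul_one,
        pderiv_shift]
      simp only [quadPoly, shift, map_neg, map_mul, map_pow, map_zero, map_one]
      rw [show (C (2 : ℂ) : Symb) = 2 from rfl]
      ring
    change gaussE G.a G.d (G.obsSymb 1 (G.obsSymb 1 1)) = _
    rw [this, gaussE_quadPoly]
    simp [quantumCov, J]
    linear_combination hz2

end PacketParam
end QuantumDuffing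

end

noncomputable section

namespace QuantumDuffing

open scoped NNReal
open MvPolynomial (C X)

namespace PacketParam

variable (G : PacketParam)

/-! ### The optimal approximations -/

theorem isSymm_posSymb : G.IsSymm G.posSymb := by
  rw [posSymb_eq]
  exact (G.isSymm_obsSymb 0).add (IsSymm.id.smul (Complex.conj_ofReal _))

theorem isSymm_momSymb : G.IsSymm G.momSymb := by
  rw [momSymb_eq]
  exact (G.isSymm_obsSymb 1).add (IsSymm.id.smul (Complex.conj_ofReal _))

theorem optimal_position_four :
    IsOptimalQuadApprox (G.superposition 1) G.mean (opPow position 4)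
      (-(6 * G.a * (G.mean 0 ^ 2 + G.a))) ![4 * G.mean 0 * (G.mean 0 ^ 2 + 3 * G.a), 0]
      (Matrix.diagonal ![12 * (G.mean 0 ^ 2 + G.a), 0]) ∧
    (G.d ≠ 0 → ∀ α β R,
      IsOptimalQuadApprox (G.superposition 1) G.mean (opPow position 4) α β R →
        α = -(6 * G.a * (G.mean 0 ^ 2 + G.a)) ∧
        β = ![4 * G.mean 0 * (G.mean 0 ^ 2 + 3 * G.a), 0] ∧
        R = Matrix.diagonal ![12 * (G.mean 0 ^ 2 + G.a), 0]) := by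
  -- Replacing y⁴ and y³ in (y + κ)⁴ by H₄ + 6ay² − 3a² and H₃ + 3ay leaves the quadratic part from
  -- which the triple is read off.
  refine isOptimalQuadApprox (f := 1) (G.intertwines_position.pow 4) (G.isSymm_posSymb.pow 4)
    (Matrix.isSymm_diagonal _) G.gaussE_posSymb_four ?_
  rw [G.quadSymb_one _ _ (Matrix.isSymm_diagonal _), posSymb_pow_one, hermitePoly]
  refine MvPolynomial.funext fun x => ?_
  simp
  ring

theorem optimal_nonquadPart :
    IsOptimalQuadApprox (G.superposition 1) G.mean (nonquadPart G.mean)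
      (-(6 * (G.a : ℝ) ^ 2)) ![12 * G.mean 0 * G.a, 0] (Matrix.diagonal ![12 * (G.a : ℝ), 0]) ∧
    (G.d ≠ 0 → ∀ α β R,
      IsOptimalQuadApprox (G.superposition 1) G.mean (nonquadPart G.mean) α β R →
        α = -(6 * (G.a : ℝ) ^ 2) ∧ β = ![12 * G.mean 0 * G.a, 0] ∧
        R = Matrix.diagonal ![12 * (G.a : ℝ), 0]) := by
  have h0 := G.intertwines_centeredObs 0
  have hs := G.isSymm_obsSymb 0
  have e : (((4 * G.mean 0 : ℝ) : ℂ) • G.obsSymb 0 ^ 3 + G.obsSymb 0 ^ 4 : Symb →ₗ[ℂ] Symb) 1 =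
      C ((4 * G.mean 0 : ℝ) : ℂ) * X 0 ^ 3 + X 0 ^ 4 := by
    rw [LinearMap.add_apply, LinearMap.smul_apply, obsSymb_zero_pow_one, obsSymb_zero_pow_one,
      MvPolynomial.smul_eq_C_mul]
  refine isOptimalQuadApprox (f := 1) (((h0.pow 3).smul _).add (h0.pow 4))
    (((hs.pow 3).smul (Complex.conj_ofReal _)).add (hs.pow 4)) (Matrix.isSymm_diagonal _)
    ((congrArg _ e).trans G.gaussE_nonquad) ?_
  rw [e, G.quadSymb_one _ _ (Matrix.isSymm_diagonal _), hermitePoly]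
  refine MvPolynomial.funext fun x => ?_
  simp
  ring

theorem optimal_duffing (ω₀ f : ℝ) :
    IsOptimalQuadApprox (G.superposition 1) G.mean (duffing ω₀ f)
      (-(G.a * (ω₀ ^ 2 + 12 * f * (G.mean 0 ^ 2 + G.a)) + G.momVar) / 2)
      ![(ω₀ ^ 2 + 4 * f * (G.mean 0 ^ 2 + 3 * G.a)) * G.mean 0, G.mean 1]
      (Matrix.diagonal ![ω₀ ^ 2 + 12 * f * (G.mean 0 ^ 2 + G.a), 1]) ∧
    (G.d ≠ 0 → ∀ α β R,
      IsOptimalQuadApprox (G.superposition 1) G.mean (duffing ω₀ f) α β R →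
        α = -(G.a * (ω₀ ^ 2 + 12 * f * (G.mean 0 ^ 2 + G.a)) + G.momVar) / 2 ∧
        β = ![(ω₀ ^ 2 + 4 * f * (G.mean 0 ^ 2 + 3 * G.a)) * G.mean 0, G.mean 1] ∧
        R = Matrix.diagonal ![ω₀ ^ 2 + 12 * f * (G.mean 0 ^ 2 + G.a), 1]) := by
  have hp := G.intertwines_momentum
  have hq := G.intertwines_position
  have sp := G.isSymm_momSymb
  have sq := G.isSymm_posSymb
  have hc : starRingEnd ℂ (1 / 2) = 1 / 2 := by simp [Complex.conj_ofNat]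
  refine isOptimalQuadApprox (f := f) (m := (G.momVar + G.mean 1 ^ 2) / 2 +
      ω₀ ^ 2 / 2 * (G.a + G.mean 0 ^ 2) +
      f * (G.mean 0 ^ 4 + 6 * G.mean 0 ^ 2 * G.a + 3 * G.a ^ 2))
    ((((hp.pow 2).smul _).add ((hq.pow 2).smul _)).add ((hq.pow 4).smul _))
    ((((sp.pow 2).smul hc).add ((sq.pow 2).smul (Complex.conj_ofReal _))).add
      ((sq.pow 4).smul (Complex.conj_ofReal _))) (Matrix.isSymm_diagonal _) ?_ ?_
  · simp only [LinearMap.add_apply, LinearMap.smul_apply, map_add (gaussE G.a G.d),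
      map_smul (gaussE G.a G.d), gaussE_momSymb_sq, gaussE_posSymb_sq, gaussE_posSymb_four,
      smul_eq_mul]
    push_cast
    ring
  -- The terms in p² and q² are quadratic and are reproduced exactly; only f q⁴ leaves a residual.
  · rw [G.quadSymb_one _ _ (Matrix.isSymm_diagonal _), hermitePoly]
    simp only [LinearMap.add_apply, LinearMap.smul_apply, momSymb_sq_one, posSymb_pow_one,
      MvPolynomial.smul_eq_C_mul]
    refine MvPolynomial.funext fun x => ?_
    simp
    ring

end PacketParam

end QuantumDuffing
end
open QuantumDuffing
-- The main theorem
theorem mainTheorem5 (ω₀ f : ℝ) (ρ : L2 →L[ℂ] L2) (μ : Fin 2 → ℝ) (C : Matrix (Fin 2) (Fin 2) ℝ)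
    (hρ : IsGaussianState ρ μ C) :
    -- `μ = E x`, and `S = E (ξ ξᵀ)`; in particular `κ = μ 0 = E q` and `σ₁₁ = C 0 0 = E ((q - κ)²)`
    (∀ j, HasExpectation ρ (obs j) (μ j)) ∧
    (∀ j k, HasExpectation ρ (opMul (centeredObs μ j) (centeredObs μ k)) (quantumCov C j k)) ∧
    -- the optimal quadratic approximation of the Hamiltonian
    IsOptimalQuadApprox ρ μ (duffing ω₀ f) (-(C * ROpt ω₀ f μ C).trace / 2)
      (betaOpt ω₀ f μ C) (ROpt ω₀ f μ C) ∧
    -- the optimal quadratic approximations of `4 κ χ³ + χ⁴` and of `q⁴` do not involve `p`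
    IsOptimalQuadApprox ρ μ (nonquadPart μ) (-(6 * C 0 0 ^ 2))
      ![12 * μ 0 * C 0 0, 0] (Matrix.diagonal ![12 * C 0 0, 0]) ∧
    IsOptimalQuadApprox ρ μ (opPow position 4) (-(6 * C 0 0 * (μ 0 ^ 2 + C 0 0)))
      ![4 * μ 0 * (μ 0 ^ 2 + 3 * C 0 0), 0] (Matrix.diagonal ![12 * (μ 0 ^ 2 + C 0 0), 0]) ∧
    -- the optimal parameters are unique if the quantum covariance matrix is nonsingular
    ((quantumCov C).det ≠ 0 → ∀ (α : ℝ) (β : Fin 2 → ℝ) (R : Matrix (Fin 2) (Fin 2) ℝ),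
      (IsOptimalQuadApprox ρ μ (duffing ω₀ f) α β R →
        α = -(C * ROpt ω₀ f μ C).trace / 2 ∧ β = betaOpt ω₀ f μ C ∧ R = ROpt ω₀ f μ C) ∧
      (IsOptimalQuadApprox ρ μ (nonquadPart μ) α β R →
        α = -(6 * C 0 0 ^ 2) ∧ β = ![12 * μ 0 * C 0 0, 0] ∧
          R = Matrix.diagonal ![12 * C 0 0, 0]) ∧
      (IsOptimalQuadApprox ρ μ (opPow position 4) α β R →
        α = -(6 * C 0 0 * (μ 0 ^ 2 + C 0 0)) ∧ β = ![4 * μ 0 * (μ 0 ^ 2 + 3 * C 0 0), 0] ∧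
          R = Matrix.diagonal ![12 * (μ 0 ^ 2 + C 0 0), 0])) := by
  have ha : (hρ.packet.a : ℝ) = C 0 0 := rfl
  have hd : (hρ.packet.d : ℝ) = C 1 1 - (C 0 1 ^ 2 + 1 / 4) / C 0 0 := rfl
  have hv : hρ.packet.momVar = C 1 1 := by
    rw [PacketParam.momVar, ha, hd]
    change (C 0 1 ^ 2 + 1 / 4) / C 0 0 + _ = _
    ring
  have hC : !![(hρ.packet.a : ℝ), hρ.packet.b; hρ.packet.b, hρ.packet.momVar] = C := by
    rw [hv, ha]
    ext j k
    fin_cases j <;> fin_cases k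
    exacts [rfl, rfl, hρ.isSymm.apply 1 0, rfl]
  have hα : -(C * ROpt ω₀ f μ C).trace / 2 =
      -(C 0 0 * (ω₀ ^ 2 + 12 * f * (μ 0 ^ 2 + C 0 0)) + C 1 1) / 2 := by
    simp [ROpt, Matrix.trace, Fin.sum_univ_two]
  have hβ : betaOpt ω₀ f μ C = ![(ω₀ ^ 2 + 4 * f * (μ 0 ^ 2 + 3 * C 0 0)) * μ 0, μ 1] := by
    ext j
    fin_cases j <;> simp [betaOpt, Matrix.mulVec_diagonal]
  -- det S = σ₁₁σ₂₂ − σ₁₂² − 1/4 = ad, so d = 0 would make S singular.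
  have hdet : (quantumCov C).det ≠ 0 → hρ.packet.d ≠ 0 := by
    intro h hd0
    apply h
    have h0 : C 1 1 - (C 0 1 ^ 2 + 1 / 4) / C 0 0 = 0 := by rw [← hd, hd0]; rfl
    have h1 : C 0 0 * C 1 1 = C 0 1 ^ 2 + 1 / 4 := by
      have := hρ.uncertainty.1.ne'
      field_simp at h0
      linarith
    have h2 : (C 0 0 : ℂ) * C 1 1 = C 0 1 ^ 2 + 1 / 4 := by
      have := congrArg (fun r : ℝ => (r : ℂ)) h1
      push_cast at this
      exact this
    have h3 : C 1 0 = C 0 1 := hρ.isSymm.apply 0 1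
    rw [Matrix.det_fin_two]
    simp [quantumCov, J, h3]
    linear_combination h2 + Complex.I_sq / 4
  have hρ' := hρ.eq_superposition
  have h1 := hρ.packet.hasExpectation_obs
  have h2 := hρ.packet.hasExpectation_mul
  have h3 := hρ.packet.optimal_duffing ω₀ f
  have h4 := hρ.packet.optimal_nonquadPart
  have h5 := hρ.packet.optimal_position_four
  rw [← hρ'] at h1 h2 h3 h4 h5
  rw [hC] at h2
  rw [hv, ha] at h3
  rw [hα, hβ]
  exact ⟨h1, h2, h3.1, h4.1, h5.1, fun h α β R =>
    ⟨h3.2 (hdet h) α β R, h4.2 (hdet h) α β R, h5.2 (hdet h) α β R⟩⟩
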